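/- Let $0<\delta\le 1$. Let $X_1,X_2,\ldots$ be independent (not necessarily identically distributed) random variables on a probability space with ${\sf E}X_i=0$ and $0<\sigma_i^2={\sf Var}\,X_i<\infty$. Put $B_n^2=\sigma_1^2+\cdots+\sigma_n^2$ (with $B_n>0$ for $n\ge1$ and $B_0^2=0$) and $S^*_n=X_1+\cdots+X_n$ (with $S^*_0=0$), and assume the Lindeberg condition: for every $\tau>0$, $$\lim_{n\to\infty}\frac1{B_n^2}\sum_{i=1}^n{\sf E}\big[X_i^2\,\mathbf 1(|X_i|\ge\tau B_n)\big]=0 .$$ Let $N_1,N_2,\ldots$ be random variables on the same probability space with values in $\{0,1,2,\ldots\}$ such that, for each $n$, $N_n$ is independent of the sequence $(X_i)_{i\ge1}$, and $N_n\to\infty$ in probability, that is, ${\sf P}(N_n\le m)\to0$ for every $m\in(0,\infty)$. Let $d_n>0$ with $d_n\to\infty$. Let $f_\delta(x)=-\frac{d}{dx}E_\delta(-x^\delta)$, $x>0$, where $E_\delta(z)=\sum_{n\ge0}z^n/\Gamma(\delta n+1)$; this is the density of the Mittag-Leffler distribution with Laplace transform $1/(1+s^\delta)$. The symmetric two-sided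 Mittag-Leffler distribution with parameter $\delta$ is the distribution on $\mathbb R$ with density $\frac12 f_\delta(|x|)$. Let $H_\delta$ be the distribution of $$2\,W\,(S/S')^2,$$ where $W,S,S'$ are independent, $W$ is standard exponential, and $S$ and $S'$ have the one-sided strictly stable distribution with characteristic function $t\mapsto\exp\{-|t|^\delta e^{-\frac12 i\pi\delta\,\mathrm{sign}\,t}\}$ (Laplace transform $e^{-s^\delta}$). Then, as $n\to\infty$, $S^*_{N_n}/d_n$ converges in law to the symmetric two-sided Mittag-Leffler distribution with parameter $\delta$ if and only if $B^2_{N_n}/d_n^2$ converges in law to $H_\delta$. -/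

import Mathlib

open MeasureTheory ProbabilityTheory Filter
open scoped Topology

/-- Characteristic function of the strictly stable law with characteristic exponent `α` and shape
parameter `θ`: `exp (-|t| ^ α * exp (-(i π θ α sign t) / 2))`. The value `θ = 1`, `0 < α ≤ 1`, is
the one-sided (positive) case, with Laplace transform `exp (-s ^ α)`. -/
noncomputable def stableCharFun (α θ : ℝ) (t : ℝ) : ℂ :=
  Complex.exp (-((|t| ^ α : ℝ) : ℂ) *
    Complex.exp (-(Complex.I * Real.pi * θ * α * (Real.sign t : ℝ)) / 2))

theorem stableCharFun_zero {α θ : ℝ} (h : 0 < α) : stableCharFun α θ 0 = 1 := by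
  simp [stableCharFun, Real.zero_rpow h.ne']

/-! ### Existence of the one-sided strictly stable laws

They are obtained as limits of normalized sums of independent variables with the Sibuya law, whose
generating function is `1 - (1 - z) ^ α`. -/

/-- The Sibuya law gives this mass to the integer `k + 1`. -/
noncomputable def sibuyaCoeff (α : ℝ) (k : ℕ) : ℝ := (-1) ^ k * Ring.choose α (k + 1)

theorem choose_succ_mul (α : ℝ) (k : ℕ) :
    Ring.choose α (k + 1) = Ring.choose α k * ((α - k) / (k + 1)) := by
  rw [Ring.choose_eq_smul, Ring.choose_eq_smul, descPochhammer_succ_right,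
    Polynomial.smeval_mul, Nat.factorial_succ]
  have : ((k : ℝ) + 1) ≠ 0 := by positivity
  have h2 : (k.factorial : ℝ) ≠ 0 := by positivity
  simp [Polynomial.smeval_sub, Polynomial.smeval_X, Polynomial.smeval_natCast]
  field_simp

theorem sibuyaCoeff_nonneg {α : ℝ} (h0 : 0 < α) (h1 : α ≤ 1) (k : ℕ) : 0 ≤ sibuyaCoeff α k := by
  induction k with
  | zero => simpa [sibuyaCoeff] using h0.le
  | succ k ih =>
    have : sibuyaCoeff α (k + 1) = sibuyaCoeff α k * (((k + 1 : ℕ) - α) / ((k + 1 : ℕ) + 1)) := by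
      unfold sibuyaCoeff
      rw [choose_succ_mul α (k + 1)]
      ring
    rw [this]
    refine mul_nonneg ih (div_nonneg ?_ (by positivity))
    push_cast
    have : (0 : ℝ) ≤ k := by positivity
    linarith

theorem hasSum_sibuya_of_norm_lt (α : ℝ) {z : ℂ} (hz : ‖z‖ < 1) :
    HasSum (fun k : ℕ => (sibuyaCoeff α k : ℂ) * z ^ (k + 1)) (1 - (1 - z) ^ (α : ℂ)) := by
  have h := (Complex.one_add_cpow_hasFPowerSeriesOnBall_zero (a := (α : ℂ))).hasSum
    (y := -z) (by
      rw [Metric.mem_eball, edist_zero_right, enorm_neg, ← ofReal_norm]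
      exact ENNReal.ofReal_lt_one.2 hz)
  simp only [binomialSeries_apply, List.ofFn_const, List.prod_replicate, zero_add] at h
  rw [← hasSum_nat_add_iff' 1] at h
  simp only [Finset.range_one, Finset.sum_singleton, Ring.choose_zero_right, pow_zero,
    smul_eq_mul, mul_one] at h
  have h' := h.neg
  rw [neg_sub, ← sub_eq_add_neg] at h'
  have e : (fun k : ℕ => (sibuyaCoeff α k : ℂ) * z ^ (k + 1)) =
      fun k : ℕ => -(Ring.choose (α : ℂ) (k + 1) * (-z) ^ (k + 1)) := by
    funext k
    rw [sibuyaCoeff, Complex.ofReal_mul, Complex.ofReal_choose, neg_pow z]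
    push_cast
    ring
  rw [e]
  exact h'

theorem hasSum_sibuya_one {α : ℝ} (h0 : 0 < α) (h1 : α ≤ 1) :
    Summable (sibuyaCoeff α) := by
  refine summable_of_sum_range_le (c := 1) (sibuyaCoeff_nonneg h0 h1) fun n => ?_
  have key : ∀ r : ℝ, 0 < r → r < 1 →
      ∑ k ∈ Finset.range n, sibuyaCoeff α k * r ^ (k + 1) ≤ 1 := by
    intro r hr hr1
    have h := hasSum_sibuya_of_norm_lt α (z := (r : ℂ)) (by simpa [abs_of_pos hr] using hr1)
    have e : (1 - (1 - (r : ℂ)) ^ (α : ℂ)) = ((1 - (1 - r) ^ α : ℝ) : ℂ) := by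
      push_cast
      rw [Complex.ofReal_cpow (by linarith)]
      push_cast; rfl
    rw [e] at h
    have h' : HasSum (fun k : ℕ => sibuyaCoeff α k * r ^ (k + 1)) (1 - (1 - r) ^ α) := by
      exact_mod_cast h
    refine (sum_le_hasSum _ (fun k _ => mul_nonneg (sibuyaCoeff_nonneg h0 h1 k) (by positivity))
      h').trans ?_
    have : 0 ≤ (1 - r) ^ α := Real.rpow_nonneg (by linarith) _
    linarith
  have hc : Tendsto (fun r : ℝ => ∑ k ∈ Finset.range n, sibuyaCoeff α k * r ^ (k + 1)) (𝓝[<] 1)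
      (𝓝 (∑ k ∈ Finset.range n, sibuyaCoeff α k)) := by
    have : Continuous (fun r : ℝ => ∑ k ∈ Finset.range n, sibuyaCoeff α k * r ^ (k + 1)) := by
      fun_prop
    have := (this.tendsto 1).mono_left (nhdsWithin_le_nhds (s := Set.Iio 1))
    simpa using this
  refine le_of_tendsto hc ?_
  filter_upwards [Ioo_mem_nhdsLT (show (0 : ℝ) < 1 by norm_num)] with r hr using key r hr.1 hr.2

theorem tsum_sibuya {α : ℝ} (h0 : 0 < α) (h1 : α ≤ 1) {z : ℂ} (hz : ‖z‖ = 1) :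
    ∑' k : ℕ, (sibuyaCoeff α k : ℂ) * z ^ (k + 1) = 1 - (1 - z) ^ (α : ℂ) := by
  have hs := hasSum_sibuya_one h0 h1
  have A : Tendsto (fun r : ℝ => ∑' k : ℕ, (sibuyaCoeff α k : ℂ) * (r * z) ^ (k + 1)) (𝓝[<] 1)
      (𝓝 (∑' k : ℕ, (sibuyaCoeff α k : ℂ) * z ^ (k + 1))) := by
    refine tendsto_tsum_of_dominated_convergence (bound := sibuyaCoeff α) hs (fun k => ?_) ?_
    · have : Continuous (fun r : ℝ => (sibuyaCoeff α k : ℂ) * (r * z) ^ (k + 1)) := by fun_prop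
      have := (this.tendsto 1).mono_left (nhdsWithin_le_nhds (s := Set.Iio 1))
      simpa using this
    · filter_upwards [Ioo_mem_nhdsLT (show (0 : ℝ) < 1 by norm_num)] with r hr k
      have hk := sibuyaCoeff_nonneg h0 h1 k
      rw [norm_mul, norm_pow, norm_mul, hz, Complex.norm_real, Complex.norm_real,
        Real.norm_of_nonneg hk, Real.norm_of_nonneg hr.1.le, mul_one]
      exact mul_le_of_le_one_right hk (pow_le_one₀ hr.1.le hr.2.le)
  have B : Tendsto (fun r : ℝ => 1 - (1 - (r * z)) ^ (α : ℂ)) (𝓝[<] 1)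
      (𝓝 (1 - (1 - z) ^ (α : ℂ))) := by
    refine tendsto_const_nhds.sub ?_
    by_cases hz1 : z = 1
    · subst hz1
      have : Tendsto (fun r : ℝ => (((1 - r) ^ α : ℝ) : ℂ)) (𝓝[<] 1) (𝓝 ((0 : ℝ) : ℂ)) := by
        refine (Complex.continuous_ofReal.tendsto _).comp ?_
        have : Continuous (fun r : ℝ => (1 - r) ^ α) :=
          (continuous_const.sub continuous_id).rpow_const fun _ => Or.inr h0.le
        have := (this.tendsto 1).mono_left (nhdsWithin_le_nhds (s := Set.Iio 1))
        simpa [Real.zero_rpow h0.ne'] using this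
      have e0 : (1 - (1 : ℂ)) ^ (α : ℂ) = ((0 : ℝ) : ℂ) := by
        simp [Complex.zero_cpow, h0.ne']
      rw [e0]
      refine this.congr' ?_
      filter_upwards [self_mem_nhdsWithin] with r hr
      rw [Complex.ofReal_cpow (by simpa using (Set.mem_Iio.1 hr).le)]
      push_cast; simp
    · have hre : z.re < 1 := by
        refine lt_of_le_of_ne ((Complex.re_le_norm z).trans hz.le) fun hre => hz1 ?_
        have := Complex.sq_norm z
        rw [hz, Complex.normSq_apply, hre] at this
        have him : z.im = 0 := by nlinarith
        exact Complex.ext (by simpa using hre) (by simpa using him)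
      have hsl : (1 - z) ∈ Complex.slitPlane := Or.inl (by simpa using hre)
      have h1 : Tendsto (fun r : ℝ => 1 - (r : ℂ) * z) (𝓝[<] 1) (𝓝 (1 - z)) := by
        have : Continuous (fun r : ℝ => 1 - (r : ℂ) * z) := by fun_prop
        have := (this.tendsto 1).mono_left (nhdsWithin_le_nhds (s := Set.Iio 1))
        simpa using this
      exact h1.cpow tendsto_const_nhds hsl
  refine tendsto_nhds_unique A (B.congr' ?_)
  filter_upwards [Ioo_mem_nhdsLT (show (0 : ℝ) < 1 by norm_num)] with r hr
  refine (hasSum_sibuya_of_norm_lt α ?_).tsum_eq.symm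
  rw [norm_mul, hz, Complex.norm_real, Real.norm_of_nonneg hr.1.le]
  linarith [hr.2]

theorem exists_sibuya {α : ℝ} (h0 : 0 < α) (h1 : α ≤ 1) :
    ∃ μ : Measure ℝ, IsProbabilityMeasure μ ∧ ∀ t : ℝ,
      charFun μ t = 1 - (1 - Complex.exp (t * Complex.I)) ^ (α : ℂ) := by
  have hs := hasSum_sibuya_one h0 h1
  have hn := sibuyaCoeff_nonneg h0 h1
  have h1' : ∑' k, sibuyaCoeff α k = 1 := by
    have := tsum_sibuya h0 h1 (z := 1) (by simp)
    simp [Complex.zero_cpow, h0.ne'] at this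
    exact_mod_cast this
  let p : PMF ℕ := ⟨fun k => ENNReal.ofReal (sibuyaCoeff α k), by
    have := (ENNReal.summable (f := fun k => ENNReal.ofReal (sibuyaCoeff α k))).hasSum
    rwa [← ENNReal.ofReal_tsum_of_nonneg hn hs, h1', ENNReal.ofReal_one] at this⟩
  have hm : Measurable (fun k : ℕ => (k : ℝ) + 1) := measurable_from_top
  refine ⟨p.toMeasure.map (fun k : ℕ => (k : ℝ) + 1),
    Measure.isProbabilityMeasure_map hm.aemeasurable, fun t => ?_⟩
  rw [charFun_apply_real, integral_map hm.aemeasurable (by fun_prop), PMF.integral_eq_tsum]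
  · rw [← tsum_sibuya h0 h1 (Complex.norm_exp_ofReal_mul_I t)]
    refine tsum_congr fun k => ?_
    have : (p k).toReal = sibuyaCoeff α k := ENNReal.toReal_ofReal (hn k)
    rw [this, ← Complex.exp_nat_mul, Complex.real_smul]
    push_cast
    ring_nf
  · refine Integrable.of_bound (measurable_from_top.aestronglyMeasurable) 1 (ae_of_all _ fun k => ?_)
    rw [← Complex.ofReal_mul, Complex.norm_exp_ofReal_mul_I]

theorem exists_charFun_pow {μ : Measure ℝ} (hμ : IsProbabilityMeasure μ) (n : ℕ) :
    ∃ ν : Measure ℝ, IsProbabilityMeasure ν ∧ ∀ t : ℝ, charFun ν t = charFun μ t ^ n := by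
  induction n with
  | zero => exact ⟨Measure.dirac 0, inferInstance, fun t => by simp [charFun_dirac]⟩
  | succ n ih =>
    obtain ⟨ν, h, hν⟩ := ih
    exact ⟨ν.conv μ, inferInstance, fun t => by rw [charFun_conv, hν, pow_succ]⟩

theorem exists_of_tendsto_charFun {μ : ℕ → Measure ℝ} (hμ : ∀ n, IsProbabilityMeasure (μ n))
    {f : ℝ → ℂ} (hf : ContinuousAt f 0)
    (h : ∀ t, Tendsto (fun n => charFun (μ n) t) atTop (𝓝 (f t))) :
    ∃ ν : Measure ℝ, IsProbabilityMeasure ν ∧ ∀ t : ℝ, charFun ν t = f t := by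
  have ht := isTightMeasureSet_of_tendsto_charFun hf h
  let P : ℕ → ProbabilityMeasure ℝ := fun n => ⟨μ n, hμ n⟩
  have hc : IsCompact (closure (Set.range P)) := by
    refine isCompact_closure_of_isTightMeasureSet ?_
    convert ht using 1
    ext ν
    constructor
    · rintro ⟨_, ⟨n, rfl⟩, rfl⟩
      exact ⟨n, rfl⟩
    · rintro ⟨n, rfl⟩
      exact ⟨P n, ⟨n, rfl⟩, rfl⟩
  obtain ⟨ν, -, hν⟩ := hc.ultrafilter_le_nhds (Ultrafilter.map P (hyperfilter ℕ)) (by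
    rw [le_principal_iff]
    exact Filter.mem_of_superset (Filter.mem_map.2 (Filter.univ_mem' fun n => Set.mem_range_self n))
      subset_closure)
  have hT : Tendsto P (hyperfilter ℕ : Filter ℕ) (𝓝 ν) := hν
  rw [ProbabilityMeasure.tendsto_iff_forall_integral_rclike_tendsto ℂ] at hT
  refine ⟨ν, inferInstance, fun t => ?_⟩
  have h1 := hT (BoundedContinuousFunction.innerProbChar t)
  simp only [← charFun_eq_integral_innerProbChar] at h1
  exact tendsto_nhds_unique h1 ((h t).mono_left (by
    simpa [Nat.cofinite_eq_atTop] using hyperfilter_le_cofinite (α := ℕ)))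

theorem stableCharFun_one_eq {α t : ℝ} (ht : t ≠ 0) :
    stableCharFun α 1 t = Complex.exp (-(-(t * Complex.I)) ^ (α : ℂ)) := by
  have hne : (-(t * Complex.I) : ℂ) ≠ 0 := by simp [ht]
  unfold stableCharFun
  congr 1
  rw [neg_mul, neg_inj]
  have hsplit : (-(t * Complex.I) : ℂ) = ((|t| : ℝ) : ℂ) * (-(Real.sign t : ℝ) * Complex.I) := by
    rcases lt_or_gt_of_ne ht with h | h
    · rw [Real.sign_of_neg h, abs_of_neg h]; push_cast; ring
    · rw [Real.sign_of_pos h, abs_of_pos h]; push_cast; ring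
  have hlog : Complex.log (-(Real.sign t : ℝ) * Complex.I)
      = -(Real.sign t : ℝ) * (Real.pi / 2) * Complex.I := by
    rcases lt_or_gt_of_ne ht with h | h
    · rw [Real.sign_of_neg h]; simp [Complex.log_I]
    · rw [Real.sign_of_pos h]; simp [Complex.log_neg_I]
  have hne2 : (-(Real.sign t : ℝ) * Complex.I : ℂ) ≠ 0 := by
    intro h0; rw [hsplit, h0, mul_zero] at hne; exact hne rfl
  rw [Complex.cpow_def_of_ne_zero hne, hsplit, Complex.log_ofReal_mul (abs_pos.2 ht) hne2, hlog,
    Real.rpow_def_of_pos (abs_pos.2 ht), Complex.ofReal_exp, ← Complex.exp_add]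
  congr 1
  push_cast
  ring

theorem continuousAt_stableCharFun {α θ : ℝ} (h : 0 < α) :
    ContinuousAt (stableCharFun α θ) 0 := by
  unfold ContinuousAt
  rw [stableCharFun_zero h]
  unfold stableCharFun
  rw [← Complex.exp_zero]
  refine (Complex.continuous_exp.tendsto 0).comp ?_
  rw [tendsto_zero_iff_norm_tendsto_zero]
  have e : ∀ t : ℝ, ‖-((|t| ^ α : ℝ) : ℂ) *
      Complex.exp (-(Complex.I * Real.pi * θ * α * (Real.sign t : ℝ)) / 2)‖ = |t| ^ α := by
    intro t
    have : -(Complex.I * Real.pi * θ * α * (Real.sign t : ℝ)) / 2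
        = ((-(Real.pi * θ * α * Real.sign t) / 2 : ℝ) : ℂ) * Complex.I := by push_cast; ring
    rw [this, norm_mul, Complex.norm_exp_ofReal_mul_I, norm_neg, Complex.norm_real, mul_one,
      Real.norm_of_nonneg (by positivity)]
  simp_rw [e]
  have : Continuous (fun t : ℝ => |t| ^ α) := continuous_abs.rpow_const fun _ => Or.inr h.le
  simpa [Real.zero_rpow h.ne'] using this.tendsto 0

theorem exists_stable_one {α : ℝ} (h0 : 0 < α) (h1 : α ≤ 1) :
    ∃ ν : Measure ℝ, IsProbabilityMeasure ν ∧ ∀ t : ℝ, charFun ν t = stableCharFun α 1 t := by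
  obtain ⟨μ, hμ, hcf⟩ := exists_sibuya h0 h1
  choose ν hν hνcf using fun n => exists_charFun_pow hμ n
  let s : ℕ → ℝ := fun n => (n : ℝ) ^ (-α⁻¹)
  have hs0 : Tendsto s atTop (𝓝 0) :=
    (tendsto_rpow_neg_atTop (inv_pos.2 h0)).comp tendsto_natCast_atTop_atTop
  refine exists_of_tendsto_charFun (μ := fun n => (ν n).map (s n * ·))
    (fun n => Measure.isProbabilityMeasure_map (by fun_prop)) (continuousAt_stableCharFun h0)
    fun t => ?_
  simp_rw [charFun_map_mul, hνcf, hcf]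
  by_cases ht : t = 0
  · subst ht
    simp [stableCharFun_zero h0, Complex.zero_cpow, h0.ne']
  rw [stableCharFun_one_eq ht]
  simp_rw [sub_eq_add_neg (1 : ℂ) ((_ : ℂ) ^ (α : ℂ))]
  refine Complex.tendsto_one_add_pow_exp_of_tendsto ?_
  simp_rw [mul_neg]
  refine Tendsto.neg ?_
  have hs : ∀ n : ℕ, 0 < n → 0 < s n := fun n hn => Real.rpow_pos_of_pos (by exact_mod_cast hn) _
  have hd : HasDerivAt (fun u : ℝ => 1 - Complex.exp ((u * t : ℝ) * Complex.I))
      (-(t * Complex.I)) 0 := by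
    have h1 : HasDerivAt (fun u : ℝ => ((u * t : ℝ) : ℂ) * Complex.I) (t * Complex.I) 0 := by
      have := (((hasDerivAt_id (0 : ℝ)).mul_const t).ofReal_comp).mul_const Complex.I
      simpa using this
    have h2 := (h1.cexp).const_sub 1
    simpa using h2
  have hslope : Tendsto (fun n : ℕ => ((s n : ℝ) : ℂ)⁻¹ *
      (1 - Complex.exp ((s n * t : ℝ) * Complex.I))) atTop (𝓝 (-(t * Complex.I))) := by
    have hs0' : Tendsto s atTop (𝓝[≠] 0) := by
      refine tendsto_nhdsWithin_iff.2 ⟨hs0, ?_⟩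
      filter_upwards [eventually_gt_atTop 0] with n hn using (hs n hn).ne'
    have := (hasDerivAt_iff_tendsto_slope_zero.1 hd).comp hs0'
    simpa [Function.comp_def] using this
  have hsl : (-(t * Complex.I) : ℂ) ∈ Complex.slitPlane := Or.inr (by simpa using ht)
  have hpow := hslope.cpow (tendsto_const_nhds (x := (α : ℂ))) hsl
  have hev : ∀ᶠ n : ℕ in atTop, ((s n : ℝ) : ℂ)⁻¹ *
      (1 - Complex.exp ((s n * t : ℝ) * Complex.I)) ≠ 0 :=
    hslope.eventually_ne (Complex.slitPlane_ne_zero hsl)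
  refine hpow.congr' ?_
  filter_upwards [hev, eventually_gt_atTop 0] with n hne hn
  set w : ℂ := ((s n : ℝ) : ℂ)⁻¹ * (1 - Complex.exp ((s n * t : ℝ) * Complex.I)) with hw
  have hsn := hs n hn
  have hsne : ((s n : ℝ) : ℂ) ≠ 0 := by exact_mod_cast hsn.ne'
  have e1 : 1 - Complex.exp ((s n * t : ℝ) * Complex.I) = ((s n : ℝ) : ℂ) * w := by
    rw [hw, mul_inv_cancel_left₀ hsne]
  have e2 : Real.log (s n) * α = - Real.log n := by
    simp only [s]
    rw [Real.log_rpow (by exact_mod_cast hn)]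
    field_simp
  rw [e1, Complex.cpow_def_of_ne_zero (mul_ne_zero hsne hne), Complex.log_ofReal_mul hsn hne,
    add_mul, Complex.exp_add, ← Complex.ofReal_mul, e2, ← Complex.ofReal_exp, Real.exp_neg,
    Real.exp_log (by exact_mod_cast hn), ← Complex.cpow_def_of_ne_zero hne]
  have : (n : ℂ) ≠ 0 := by exact_mod_cast hn.ne'
  push_cast
  rw [mul_inv_cancel_left₀ this]

/-- The one-sided strictly stable law with characteristic exponent `α`, that is, the probability
measure on `ℝ` with characteristic function `stableCharFun α 1`. It exists for `0 < α ≤ 1` and is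
unique; for the other values of `α` the definition is a convention without significance. -/
noncomputable def oneSidedStableLaw (α : ℝ) : Measure ℝ :=
  open scoped Classical in
  if h : 0 < α ∧ α ≤ 1 then (exists_stable_one h.1 h.2).choose else Measure.dirac 0

instance isProbabilityMeasure_oneSidedStableLaw (α : ℝ) :
    IsProbabilityMeasure (oneSidedStableLaw α) := by
  unfold oneSidedStableLaw
  split_ifs with h
  · exact (exists_stable_one h.1 h.2).choose_spec.1
  · infer_instance

theorem charFun_oneSidedStableLaw {α : ℝ} (h0 : 0 < α) (h1 : α ≤ 1) (t : ℝ) :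
    charFun (oneSidedStableLaw α) t = stableCharFun α 1 t := by
  unfold oneSidedStableLaw
  rw [dif_pos ⟨h0, h1⟩]
  exact (exists_stable_one h0 h1).choose_spec.2 t

/-! ### The limit laws -/

/-- The Mittag-Leffler function `E_δ(z) = ∑ zⁿ / Γ(δ n + 1)` on the real line. -/
noncomputable def mittagLefflerE (δ z : ℝ) : ℝ :=
  ∑' n : ℕ, z ^ n / Real.Gamma (δ * n + 1)

/-- The density `-(d/dx) E_δ(-x ^ δ)`, `x > 0`, of the (one-sided) Mittag-Leffler law with
Laplace transform `1 / (1 + s ^ δ)`. -/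
noncomputable def mittagLefflerDensity (δ x : ℝ) : ℝ :=
  -deriv (fun y : ℝ => mittagLefflerE δ (-(y ^ δ))) x

/-- The symmetric two-sided Mittag-Leffler law, with density `f(|x|) / 2`, where `f` is the
Mittag-Leffler density. (The point `x = 0` is immaterial.) -/
noncomputable def symmMittagLefflerLaw (δ : ℝ) : Measure ℝ :=
  volume.withDensity fun x : ℝ => ENNReal.ofReal (mittagLefflerDensity δ |x| / 2)

/-- The mixing law `H_δ`: the law of `2 * W * (S / S') ^ 2` where `W`, `S`, `S'` are independent,
`W` is standard exponential, and `S`, `S'` have the one-sided strictly stable law with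
characteristic exponent `δ`. -/
noncomputable def mixingLaw (δ : ℝ) : Measure ℝ :=
  ((expMeasure 1).prod ((oneSidedStableLaw δ).prod (oneSidedStableLaw δ))).map
    fun p : ℝ × ℝ × ℝ => 2 * p.1 * (p.2.1 / p.2.2) ^ 2

/-- Convergence in law (weak convergence) of a sequence of probability measures on `ℝ`: the
integrals of all bounded continuous functions converge. -/
def ConvergesInLaw (μ : ℕ → Measure ℝ) (ν : Measure ℝ) : Prop :=
  ∀ f : BoundedContinuousFunction ℝ ℝ,
    Tendsto (fun n => ∫ x, f x ∂(μ n)) atTop (𝓝 (∫ x, f x ∂ν))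

/-! ### Random sums

A sequence `X₁, X₂, …` is written `X 0, X 1, …`, so that the `n`-th partial sum runs over the
indices in `Finset.range n`; empty sums are zero. -/

section RandomSums

variable {Ω : Type*} [MeasurableSpace Ω]

/-- `B_n ^ 2`, the sum of the variances of the first `n` variables. -/
noncomputable def varianceSum (X : ℕ → Ω → ℝ) (P : Measure Ω) (n : ℕ) : ℝ :=
  ∑ i ∈ Finset.range n, variance (X i) P

/-- The Lindeberg condition: for every `τ > 0`,
`B_n⁻² * ∑_{i ≤ n} E[X_i ^ 2; |X_i| ≥ τ * B_n] → 0`. -/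
def LindebergCondition (X : ℕ → Ω → ℝ) (P : Measure Ω) : Prop :=
  ∀ τ : ℝ, 0 < τ →
    Tendsto (fun n : ℕ => 1 / varianceSum X P n *
      ∑ i ∈ Finset.range n,
        ∫ ω in {ω | τ * Real.sqrt (varianceSum X P n) ≤ |X i ω|}, X i ω ^ 2 ∂P)
      atTop (𝓝 0)

/-- `N_n → ∞` in probability: `P(N_n ≤ m) → 0` for every `m ∈ (0, ∞)`. -/
def TendsToInftyInProbability (N : ℕ → Ω → ℕ) (P : Measure Ω) : Prop :=
  ∀ m : ℝ, 0 < m → Tendsto (fun n : ℕ => P {ω | (N n ω : ℝ) ≤ m}) atTop (𝓝 0)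

end RandomSums

/-! ### The one-sided stable law lives on `(0, ∞)` and has Laplace transform `exp (-s ^ α)` -/

/-! Write `V_n = B²_{N_n} / d_n²`. Conditionally on `N_n = k`, the random sum is `S*_k / d_n`, and
Lindeberg's theorem replaces its characteristic function at `t` by `exp (-(t² / 2) B_k² / d_n²)`.
The replacement is uniform while `|t| B_k / d_n` stays bounded, so if `V_n` is tight the
characteristic function of the random sum at `t` differs by `o(1)` from the Laplace transform of
`V_n` at `t² / 2` (`tendsto_charFun_randomSum_sub`).

The two limit laws are related in the same way. Let `T = S' / S`. Writing `1 / (s + T)` as an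
exponential integral gives `E[1 / (s + T)] = s ^ (δ - 1) / (1 + s ^ δ)`, which for `s > 1` is also
the Laplace transform of `x ↦ E_δ(-x ^ δ)`. By uniqueness `E_δ(-x ^ δ) = E[exp (-x T)]` for `x > 0`,
so the Mittag-Leffler density is `E[T exp (-x T)]`, a mixture of exponential densities. The
symmetric law is then a mixture of Laplace laws, with characteristic function `E[T² / (T² + u²)]`.
Integrating out `W` shows that this is the Laplace transform of `2 W / T²`, that is of `H_δ`, at `u²
/ 2`.

The equivalence follows from the continuity theorems for the two transforms. If `V_n` converges, it
is tight and nothing more is needed. If the random sums converge, tightness of `V_n` has to be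
extracted from that of the sums: for large `k`, `|S*_k|` exceeds `B_k / 2` with probability at least
`1 / 16`, so a large `V_n` would force large random sums (`exists_measureReal_varianceSum_le`).

The stable law is given only by its characteristic function; its positivity and Laplace transform
come from its approximation by normalized Sibuya sums. -/

theorem tsum_sibuya_of_norm_le_one {α : ℝ} (h0 : 0 < α) (h1 : α ≤ 1) {z : ℂ} (hz : ‖z‖ ≤ 1) :
    ∑' k : ℕ, (sibuyaCoeff α k : ℂ) * z ^ (k + 1) = 1 - (1 - z) ^ (α : ℂ) := by
  rcases hz.lt_or_eq with h | h
  · exact (hasSum_sibuya_of_norm_lt α h).tsum_eq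
  · exact tsum_sibuya h0 h1 h

theorem norm_cexp_mul_le_one {z : ℂ} (hz : z.re ≤ 0) {x : ℝ} (hx : 0 ≤ x) :
    ‖Complex.exp (z * x)‖ ≤ 1 := by
  rw [Complex.norm_exp, Real.exp_le_one_iff]
  simpa using mul_nonpos_of_nonpos_of_nonneg hz hx

/-- The closed left half-plane contains both the imaginary axis, where the limit of the normalized
sums is identified, and the negative real axis, where its Laplace transform is read off. -/
theorem exists_sibuya_complexMGF {α : ℝ} (h0 : 0 < α) (h1 : α ≤ 1) :
    ∃ μ : Measure ℝ, IsProbabilityMeasure μ ∧ (∀ᵐ x ∂μ, 0 ≤ x) ∧ ∀ z : ℂ, z.re ≤ 0 →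
      ∫ x : ℝ, Complex.exp (z * x) ∂μ = 1 - (1 - Complex.exp z) ^ (α : ℂ) := by
  have hs := hasSum_sibuya_one h0 h1
  have hn := sibuyaCoeff_nonneg h0 h1
  have h1' : ∑' k, sibuyaCoeff α k = 1 := by
    have := tsum_sibuya h0 h1 (z := 1) (by simp)
    simp [Complex.zero_cpow, h0.ne'] at this
    exact_mod_cast this
  let p : PMF ℕ := ⟨fun k => ENNReal.ofReal (sibuyaCoeff α k), by
    have := (ENNReal.summable (f := fun k => ENNReal.ofReal (sibuyaCoeff α k))).hasSum
    rwa [← ENNReal.ofReal_tsum_of_nonneg hn hs, h1', ENNReal.ofReal_one] at this⟩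
  have hm : Measurable (fun k : ℕ => (k : ℝ) + 1) := measurable_from_top
  refine ⟨p.toMeasure.map (fun k : ℕ => (k : ℝ) + 1),
    Measure.isProbabilityMeasure_map hm.aemeasurable, ?_, fun z hz => ?_⟩
  · rw [ae_map_iff hm.aemeasurable measurableSet_Ici]
    exact ae_of_all _ fun k => by positivity
  rw [integral_map hm.aemeasurable (by fun_prop), PMF.integral_eq_tsum]
  · rw [← tsum_sibuya_of_norm_le_one h0 h1 (z := Complex.exp z)
      (by rw [Complex.norm_exp, Real.exp_le_one_iff]; exact hz)]
    refine tsum_congr fun k => ?_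
    have : (p k).toReal = sibuyaCoeff α k := ENNReal.toReal_ofReal (hn k)
    rw [this, ← Complex.exp_nat_mul, Complex.real_smul]
    push_cast
    ring_nf
  · refine Integrable.of_bound (measurable_from_top.aestronglyMeasurable) 1 (ae_of_all _ fun k => ?_)
    exact norm_cexp_mul_le_one hz (by positivity)

theorem exists_complexMGF_pow {μ : Measure ℝ} (hμ : IsProbabilityMeasure μ)
    (hpos : ∀ᵐ x ∂μ, 0 ≤ x) (n : ℕ) :
    ∃ ν : Measure ℝ, IsProbabilityMeasure ν ∧ (∀ᵐ x ∂ν, 0 ≤ x) ∧ ∀ z : ℂ,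
      ∫ x : ℝ, Complex.exp (z * x) ∂ν = (∫ x : ℝ, Complex.exp (z * x) ∂μ) ^ n := by
  induction n with
  | zero =>
    refine ⟨Measure.dirac 0, inferInstance, ?_, fun t => by simp⟩
    rw [ae_dirac_iff measurableSet_Ici]
  | succ n ih =>
    obtain ⟨ν, h, hν0, hν⟩ := ih
    refine ⟨ν.conv μ, inferInstance, ?_, fun z => ?_⟩
    · rw [Measure.conv, ae_map_iff (by fun_prop) measurableSet_Ici]
      filter_upwards [Measure.quasiMeasurePreserving_fst.ae hν0,
        Measure.quasiMeasurePreserving_snd.ae hpos] with p h1 h2 using add_nonneg h1 h2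
    · rw [Measure.conv, integral_map (by fun_prop) (by fun_prop), pow_succ, ← hν,
        ← integral_prod_mul]
      refine integral_congr_ae (ae_of_all _ fun p => ?_)
      simp only [Complex.ofReal_add, mul_add, Complex.exp_add]

/-- Portmanteau for the open set `(-∞, 0)`. The filter is arbitrary because limits along
ultrafilters also occur. -/
theorem ae_nonneg_of_tendsto {ι : Type*} {l : Filter ι} [l.NeBot] {μ : ι → ProbabilityMeasure ℝ}
    {ν : ProbabilityMeasure ℝ} (h : Tendsto μ l (𝓝 ν)) (h0 : ∀ i, ∀ᵐ x ∂(μ i : Measure ℝ), 0 ≤ x) :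
    ∀ᵐ x ∂(ν : Measure ℝ), 0 ≤ x := by
  have := ProbabilityMeasure.le_liminf_measure_open_of_tendsto h (isOpen_Iio (a := (0 : ℝ)))
  have e : ∀ i, (μ i : Measure ℝ) (Set.Iio 0) = 0 := fun i => by
    have := h0 i
    rw [ae_iff] at this
    simpa [Set.Iio] using this
  simp_rw [e, liminf_const, nonpos_iff_eq_zero] at this
  rw [ae_iff]
  simpa [Set.Iio] using this

/-- The bounded continuous function `x ↦ exp (-s |x|)`. -/
noncomputable def expNegAbsBCF (s : ℝ) (hs : 0 ≤ s) : BoundedContinuousFunction ℝ ℝ :=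
  BoundedContinuousFunction.ofNormedAddCommGroup (fun x => Real.exp (-(s * |x|))) (by fun_prop) 1
    (fun x => by
      rw [Real.norm_of_nonneg (Real.exp_nonneg _), Real.exp_le_one_iff]
      have := mul_nonneg hs (abs_nonneg x)
      linarith)

/-- For `s > 0` the function `exp (-s x)` is unbounded on the line, hence no test function for weak
convergence; on laws carried by `[0, ∞)` the absolute value costs nothing. -/
theorem integral_expNegAbsBCF {μ : Measure ℝ} (hμ : ∀ᵐ x ∂μ, 0 ≤ x) (s : ℝ) (hs : 0 ≤ s) :
    ∫ x, expNegAbsBCF s hs x ∂μ = ∫ x, Real.exp (-(s * x)) ∂μ := by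
  refine integral_congr_ae (hμ.mono fun x hx => ?_)
  simp [expNegAbsBCF, abs_of_nonneg hx]

/-- With `s = n ^ (-1 / α)`, `1 - exp (z s)` is close to `-z s`, and its `α`-th power to `(-z) ^ α /
n`; then `(1 + c / n) ^ n → exp c`. The slit plane provides continuity of the principal power. -/
theorem tendsto_one_sub_sibuya_pow {α : ℝ} (h0 : 0 < α) {z : ℂ} (hz : -z ∈ Complex.slitPlane) :
    Tendsto (fun n : ℕ => (1 - (1 - Complex.exp (z * ((n : ℝ) ^ (-α⁻¹) : ℝ))) ^ (α : ℂ)) ^ n) atTop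
      (𝓝 (Complex.exp (-(-z) ^ (α : ℂ)))) := by
  let s : ℕ → ℝ := fun n => (n : ℝ) ^ (-α⁻¹)
  have hs0 : Tendsto s atTop (𝓝 0) :=
    (tendsto_rpow_neg_atTop (inv_pos.2 h0)).comp tendsto_natCast_atTop_atTop
  simp_rw [sub_eq_add_neg (1 : ℂ) ((_ : ℂ) ^ (α : ℂ))]
  refine Complex.tendsto_one_add_pow_exp_of_tendsto ?_
  simp_rw [mul_neg]
  refine Tendsto.neg ?_
  have hs : ∀ n : ℕ, 0 < n → 0 < s n := fun n hn => Real.rpow_pos_of_pos (by exact_mod_cast hn) _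
  have hd : HasDerivAt (fun u : ℝ => 1 - Complex.exp (z * u)) (-z) 0 := by
    have h1 : HasDerivAt (fun u : ℝ => z * (u : ℂ)) z 0 := by
      have := ((hasDerivAt_id (0 : ℝ)).ofReal_comp).const_mul z
      simpa using this
    have h2 := (h1.cexp).const_sub 1
    simpa using h2
  have hslope : Tendsto (fun n : ℕ => ((s n : ℝ) : ℂ)⁻¹ *
      (1 - Complex.exp (z * (s n : ℝ)))) atTop (𝓝 (-z)) := by
    have hs0' : Tendsto s atTop (𝓝[≠] 0) := by
      refine tendsto_nhdsWithin_iff.2 ⟨hs0, ?_⟩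
      filter_upwards [eventually_gt_atTop 0] with n hn using (hs n hn).ne'
    have := (hasDerivAt_iff_tendsto_slope_zero.1 hd).comp hs0'
    simpa [Function.comp_def] using this
  have hpow := hslope.cpow (tendsto_const_nhds (x := (α : ℂ))) hz
  have hev : ∀ᶠ n : ℕ in atTop, ((s n : ℝ) : ℂ)⁻¹ *
      (1 - Complex.exp (z * (s n : ℝ))) ≠ 0 :=
    hslope.eventually_ne (Complex.slitPlane_ne_zero hz)
  refine hpow.congr' ?_
  filter_upwards [hev, eventually_gt_atTop 0] with n hne hn
  set w : ℂ := ((s n : ℝ) : ℂ)⁻¹ * (1 - Complex.exp (z * (s n : ℝ))) with hw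
  have hsn := hs n hn
  have hsne : ((s n : ℝ) : ℂ) ≠ 0 := by exact_mod_cast hsn.ne'
  have e1 : 1 - Complex.exp (z * (s n : ℝ)) = ((s n : ℝ) : ℂ) * w := by
    rw [hw, mul_inv_cancel_left₀ hsne]
  have e2 : Real.log (s n) * α = - Real.log n := by
    simp only [s]
    rw [Real.log_rpow (by exact_mod_cast hn)]
    field_simp
  change _ = (n : ℂ) * (1 - Complex.exp (z * (s n : ℝ))) ^ (α : ℂ)
  -- The principal logarithm is additive when one factor is a positive real, so `(s n * w) ^ α`
  -- splits off `(s n) ^ α = 1 / n`.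
  rw [e1, Complex.cpow_def_of_ne_zero (mul_ne_zero hsne hne), Complex.log_ofReal_mul hsn hne,
    add_mul, Complex.exp_add, ← Complex.ofReal_mul, e2, ← Complex.ofReal_exp, Real.exp_neg,
    Real.exp_log (by exact_mod_cast hn), ← Complex.cpow_def_of_ne_zero hne]
  have : (n : ℂ) ≠ 0 := by exact_mod_cast hn.ne'
  push_cast
  rw [mul_inv_cancel_left₀ this]

/-- Normalized Sibuya sums converge weakly to the stable law, by their transforms on the imaginary
axis. Nonnegativity survives the weak limit, and the same transforms on the negative real axis give
the Laplace transform. -/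
theorem oneSidedStableLaw_nonneg_and_laplace {α : ℝ} (h0 : 0 < α) (h1 : α ≤ 1) :
    (∀ᵐ x ∂(oneSidedStableLaw α), 0 ≤ x) ∧
      ∀ s : ℝ, 0 < s → ∫ x, Real.exp (-(s * x)) ∂(oneSidedStableLaw α) = Real.exp (-s ^ α) := by
  obtain ⟨μ, hμ, hμ0, hL⟩ := exists_sibuya_complexMGF h0 h1
  choose ν hν hν0 hνL using fun n => exists_complexMGF_pow hμ hμ0 n
  let s : ℕ → ℝ := fun n => (n : ℝ) ^ (-α⁻¹)
  have hspos : ∀ n, 0 ≤ s n := fun n => Real.rpow_nonneg (by positivity) _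
  let κ : ℕ → ProbabilityMeasure ℝ := fun n =>
    ⟨(ν n).map (s n * ·), Measure.isProbabilityMeasure_map (by fun_prop)⟩
  let ρ : ProbabilityMeasure ℝ := ⟨oneSidedStableLaw α, inferInstance⟩
  have hκ0 : ∀ n, ∀ᵐ x ∂(κ n : Measure ℝ), 0 ≤ x := fun n => by
    change ∀ᵐ x ∂((ν n).map (s n * ·)), 0 ≤ x
    rw [ae_map_iff (by fun_prop) measurableSet_Ici]
    exact (hν0 n).mono fun x hx => mul_nonneg (hspos n) hx
  have hκ : ∀ z : ℂ, z.re ≤ 0 → ∀ n, ∫ x : ℝ, Complex.exp (z * x) ∂(κ n : Measure ℝ) =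
      (1 - (1 - Complex.exp (z * (s n : ℝ))) ^ (α : ℂ)) ^ n := by
    intro z hz n
    change ∫ x : ℝ, Complex.exp (z * x) ∂((ν n).map (s n * ·)) = _
    rw [integral_map (by fun_prop) (by fun_prop), ← hL _ (by
      simpa using mul_nonpos_of_nonpos_of_nonneg hz (hspos n)), ← hνL]
    simp [mul_assoc]
  have hlim : ∀ z : ℂ, z.re ≤ 0 → -z ∈ Complex.slitPlane →
      Tendsto (fun n => ∫ x : ℝ, Complex.exp (z * x) ∂(κ n : Measure ℝ)) atTop
        (𝓝 (Complex.exp (-(-z) ^ (α : ℂ)))) := by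
    intro z hz hz'
    simp_rw [hκ z hz]
    exact tendsto_one_sub_sibuya_pow h0 hz'
  have hconv : Tendsto κ atTop (𝓝 ρ) := by
    refine ProbabilityMeasure.tendsto_iff_tendsto_charFun.2 fun t => ?_
    change Tendsto _ _ (𝓝 (charFun (oneSidedStableLaw α) t))
    rw [charFun_oneSidedStableLaw h0 h1]
    by_cases ht : t = 0
    · subst ht; simp [stableCharFun_zero h0]
    rw [stableCharFun_one_eq ht]
    have := hlim (t * Complex.I) (by simp) (Or.inr (by simpa using ht))
    refine this.congr fun n => ?_
    rw [charFun_apply_real]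
    congr! 3 with x
    ring
  refine ⟨ae_nonneg_of_tendsto hconv hκ0, fun r hr => ?_⟩
  have hw := (ProbabilityMeasure.tendsto_iff_forall_integral_tendsto.1 hconv) (expNegAbsBCF r hr.le)
  simp_rw [integral_expNegAbsBCF (hκ0 _)] at hw
  rw [integral_expNegAbsBCF (ae_nonneg_of_tendsto hconv hκ0)] at hw
  have h2 := hlim (-r : ℝ) (by simpa using hr.le) (Or.inl (by simpa using hr))
  have e1 : ∀ m : Measure ℝ, ∫ x : ℝ, Complex.exp ((-r : ℝ) * x) ∂m =
      ((∫ x : ℝ, Real.exp (-(r * x)) ∂m : ℝ) : ℂ) := fun m => by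
    rw [← integral_complex_ofReal]
    congr! 2 with x
    push_cast
    ring_nf
  have e2 : Complex.exp (-(-((-r : ℝ) : ℂ)) ^ (α : ℂ)) = ((Real.exp (-r ^ α) : ℝ) : ℂ) := by
    push_cast [Complex.ofReal_cpow hr.le]
    simp
  rw [e2] at h2
  simp_rw [e1] at h2
  refine tendsto_nhds_unique hw ?_
  simpa only [Function.comp_def, Complex.ofReal_re] using (Complex.continuous_re.tendsto _).comp h2

/-- An atom at `0` would contribute its full mass to the Laplace transform at every `s`, but `exp
(-s ^ α) → 0`. -/
theorem ae_pos_oneSidedStableLaw {α : ℝ} (h0 : 0 < α) (h1 : α ≤ 1) :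
    ∀ᵐ x ∂(oneSidedStableLaw α), 0 < x := by
  obtain ⟨hn, hL⟩ := oneSidedStableLaw_nonneg_and_laplace h0 h1
  have hle : ∀ s : ℝ, 0 < s → (oneSidedStableLaw α).real {0} ≤ Real.exp (-s ^ α) := by
    intro s hs
    rw [← hL s hs, ← integral_indicator_one (measurableSet_singleton 0)]
    refine integral_mono_ae ((integrable_const 1).indicator (measurableSet_singleton 0))
      (.of_bound (by fun_prop) 1 ?_) (ae_of_all _ fun x => ?_)
    · filter_upwards [hn] with x hx
      rw [Real.norm_of_nonneg (Real.exp_nonneg _), Real.exp_le_one_iff]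
      have := mul_nonneg hs.le hx
      linarith
    · by_cases hx : x = 0
      · simp [hx]
      · simp [hx, Real.exp_nonneg]
  have hlim : Tendsto (fun s : ℝ => Real.exp (-s ^ α)) atTop (𝓝 0) :=
    Real.tendsto_exp_neg_atTop_nhds_zero.comp (tendsto_rpow_atTop h0)
  have hz : (oneSidedStableLaw α).real {0} ≤ 0 := ge_of_tendsto hlim
    ((eventually_gt_atTop 0).mono fun s hs => hle s hs)
  have hz' : oneSidedStableLaw α {0} = 0 :=
    (measureReal_eq_zero_iff).1 (le_antisymm hz measureReal_nonneg)
  have hne : ∀ᵐ x ∂(oneSidedStableLaw α), x ≠ 0 := by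
    rw [ae_iff]; simpa using hz'
  filter_upwards [hn, hne] with x h1 h2 using lt_of_le_of_ne h1 h2.symm

/-! ### Laplace transforms of measures on `[0, ∞)` -/

theorem integrable_exp_neg_mul {μ : Measure ℝ} [IsFiniteMeasure μ] (hμ : ∀ᵐ x ∂μ, 0 ≤ x) {s : ℝ}
    (hs : 0 ≤ s) : Integrable (fun x => Real.exp (-(s * x))) μ := by
  refine .of_bound (by fun_prop) 1 (hμ.mono fun x hx => ?_)
  rw [Real.norm_of_nonneg (Real.exp_nonneg _), Real.exp_le_one_iff]
  have := mul_nonneg hs hx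
  linarith

theorem mem_interior_integrableExpSet_id {μ : Measure ℝ} [IsFiniteMeasure μ]
    (hμ : ∀ᵐ x ∂μ, 0 ≤ x) {s : ℝ} (hs : s < 0) : s ∈ interior (integrableExpSet id μ) := by
  rw [mem_interior]
  refine ⟨Set.Iio 0, fun r hr => ?_, isOpen_Iio, hs⟩
  have := integrable_exp_neg_mul hμ (s := -r) (by simpa using (Set.mem_Iio.1 hr).le)
  simpa [integrableExpSet] using this

/-- Analyticity is available only in the open half-plane; the characteristic function is reached as
a boundary value, by dominated convergence. -/
theorem tendsto_complexMGF_charFun {μ : Measure ℝ} [IsFiniteMeasure μ] (hμ : ∀ᵐ x ∂μ, 0 ≤ x)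
    (t : ℝ) : Tendsto (fun ε : ℝ => complexMGF id μ (-ε + t * Complex.I)) (𝓝[>] 0)
      (𝓝 (charFun μ t)) := by
  rw [← complexMGF_id_mul_I]
  refine tendsto_integral_filter_of_dominated_convergence (fun _ => 1) ?_ ?_
    (integrable_const _) ?_
  · exact .of_forall fun ε => by simp only [id]; fun_prop
  · filter_upwards [self_mem_nhdsWithin] with ε hε
    filter_upwards [hμ] with x hx
    exact norm_cexp_mul_le_one (by simpa using (Set.mem_Ioi.1 hε).le) hx
  · refine ae_of_all _ fun x => ?_
    have : Continuous (fun ε : ℝ => Complex.exp ((-ε + t * Complex.I) * (id x : ℝ))) := by fun_prop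
    have := (this.tendsto 0).mono_left (nhdsWithin_le_nhds (s := Set.Ioi 0))
    simpa using this

/-- A finite measure on `[0, ∞)` is determined by its Laplace transform on `(0, ∞)`. -/
theorem ext_of_laplace {μ ν : Measure ℝ} [IsFiniteMeasure μ] [IsFiniteMeasure ν]
    (hμ : ∀ᵐ x ∂μ, 0 ≤ x) (hν : ∀ᵐ x ∂ν, 0 ≤ x)
    (h : ∀ s : ℝ, 0 < s → ∫ x, Real.exp (-(s * x)) ∂μ = ∫ x, Real.exp (-(s * x)) ∂ν) : μ = ν := by
  have ha : ∀ {ρ : Measure ℝ} [IsFiniteMeasure ρ], (∀ᵐ x ∂ρ, 0 ≤ x) →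
      AnalyticOnNhd ℂ (complexMGF id ρ) {z | z.re < 0} := fun hρ z hz =>
    analyticAt_complexMGF (mem_interior_integrableExpSet_id hρ hz)
  have hreal : ∀ s : ℝ, 0 < s → complexMGF id μ ((-s : ℝ) : ℂ) = complexMGF id ν ((-s : ℝ) : ℂ) := by
    intro s hs
    rw [complexMGF_ofReal, complexMGF_ofReal]
    simpa [mgf] using h s hs
  have hEq : Set.EqOn (complexMGF id μ) (complexMGF id ν) {z | z.re < 0} := by
    -- Identity theorem on the left half-plane: the transforms agree at the points `-(1 + 1 / (n +
    -- 1))`, which accumulate at `-1`.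
    refine (ha hμ).eqOn_of_preconnected_of_frequently_eq (ha hν) (z₀ := ((-1 : ℝ) : ℂ))
      (convex_halfSpace_re_lt 0).isPreconnected (by simp) ?_
    have hs : Tendsto (fun n : ℕ => ((-(1 + 1 / ((n : ℝ) + 1)) : ℝ) : ℂ)) atTop
        (𝓝[≠] ((-1 : ℝ) : ℂ)) := by
      refine tendsto_nhdsWithin_iff.2 ⟨(Complex.continuous_ofReal.tendsto _).comp ?_, ?_⟩
      · have := (tendsto_one_div_add_atTop_nhds_zero_nat (𝕜 := ℝ)).const_add 1
        simpa using this.neg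
      · refine .of_forall fun n hn => ?_
        have h2 : (-(1 + 1 / ((n : ℝ) + 1)) : ℝ) = -1 := Complex.ofReal_injective hn
        have : (0 : ℝ) < 1 / ((n : ℝ) + 1) := by positivity
        linarith
    refine hs.frequently (.of_forall fun n => hreal _ (by positivity))
  refine Measure.ext_of_charFun (funext fun t => ?_)
  refine tendsto_nhds_unique (tendsto_complexMGF_charFun hμ t) ?_
  refine (tendsto_complexMGF_charFun hν t).congr' ?_
  filter_upwards [self_mem_nhdsWithin] with ε hε
  exact (hEq (by simpa using hε)).symm

/-- An integrable function on `(0, ∞)` with vanishing Laplace transform vanishes. -/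
theorem ae_eq_zero_of_laplace {k : ℝ → ℝ} (hk : IntegrableOn k (Set.Ioi 0))
    (h : ∀ s : ℝ, 0 < s → ∫ x in Set.Ioi 0, Real.exp (-(s * x)) * k x = 0) :
    ∀ᵐ x ∂(volume.restrict (Set.Ioi (0 : ℝ))), k x = 0 := by
  set m := volume.restrict (Set.Ioi (0 : ℝ)) with hm
  have hk' : Integrable k m := hk
  have hfin : ∀ {g : ℝ → ℝ}, Integrable g m →
      IsFiniteMeasure (m.withDensity fun x => ENNReal.ofReal (g x)) := fun hg =>
    isFiniteMeasure_withDensity_ofReal hg.2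
  have := hfin hk'
  have := hfin hk'.neg
  have hpos : ∀ {g : ℝ → ℝ}, ∀ᵐ x ∂(m.withDensity fun x => ENNReal.ofReal (g x)), 0 ≤ x := fun {g} =>
    (withDensity_absolutelyContinuous m _).ae_le
      ((ae_restrict_mem measurableSet_Ioi).mono fun x hx => (Set.mem_Ioi.1 hx).le)
  have hint : ∀ {g : ℝ → ℝ}, Integrable g m → ∀ s : ℝ,
      ∫ x, Real.exp (-(s * x)) ∂(m.withDensity fun x => ENNReal.ofReal (g x)) =
        ∫ x, Real.exp (-(s * x)) * max (g x) 0 ∂m := by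
    intro g hg s
    rw [integral_withDensity_eq_integral_toReal_smul₀ hg.1.aemeasurable.ennreal_ofReal
      (ae_of_all _ fun _ => ENNReal.ofReal_lt_top)]
    refine integral_congr_ae (ae_of_all _ fun x => ?_)
    simp only [ENNReal.toReal_ofReal', smul_eq_mul]
    ring
  have hI : ∀ {g : ℝ → ℝ}, Integrable g m → ∀ s : ℝ, 0 < s →
      Integrable (fun x => Real.exp (-(s * x)) * max (g x) 0) m := by
    intro g hg s hs
    refine hg.pos_part.bdd_mul (c := 1) (by fun_prop) ?_
    filter_upwards [ae_restrict_mem measurableSet_Ioi] with x hx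
    rw [Real.norm_of_nonneg (Real.exp_nonneg _), Real.exp_le_one_iff]
    have := mul_pos hs (Set.mem_Ioi.1 hx)
    linarith
  -- `ENNReal.ofReal` truncates at zero, so the densities `k` and `-k` give the positive and
  -- negative parts of `k` as finite measures. The hypothesis says that their Laplace transforms
  -- agree.
  have heq := ext_of_laplace (hpos (g := k)) (hpos (g := -k)) (fun s hs => by
    rw [hint hk', hint hk'.neg, ← sub_eq_zero, ← integral_sub (hI hk' s hs) (hI hk'.neg s hs)]
    refine Eq.trans ?_ (h s hs)
    refine integral_congr_ae (ae_of_all _ fun x => ?_)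
    simp only [Pi.neg_apply]
    rw [← mul_sub]
    congr 1
    rcases le_total (k x) 0 with h | h
    · rw [max_eq_right h, max_eq_left (by linarith)]; ring
    · rw [max_eq_left h, max_eq_right (by linarith)]; ring)
  have := (withDensity_eq_iff_of_sigmaFinite hk'.1.aemeasurable.ennreal_ofReal
    hk'.neg.1.aemeasurable.ennreal_ofReal).1 heq
  filter_upwards [this] with x hx
  simp only [Pi.neg_apply] at hx
  rcases le_total (k x) 0 with h | h
  · rw [ENNReal.ofReal_of_nonpos h] at hx
    have := ENNReal.ofReal_eq_zero.1 hx.symm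
    linarith
  · rw [ENNReal.ofReal_of_nonpos (p := -k x) (by linarith)] at hx
    have := ENNReal.ofReal_eq_zero.1 hx
    linarith

/-- **Continuity theorem for Laplace transforms** of a tight sequence of laws on `[0, ∞)`. -/
theorem tendsto_of_tendsto_laplace {μ : ℕ → ProbabilityMeasure ℝ} {ν : ProbabilityMeasure ℝ}
    (hμ : ∀ n, ∀ᵐ x ∂(μ n : Measure ℝ), 0 ≤ x) (hν : ∀ᵐ x ∂(ν : Measure ℝ), 0 ≤ x)
    (ht : IsTightMeasureSet (Set.range fun n => (μ n : Measure ℝ)))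
    (h : ∀ s : ℝ, 0 < s → Tendsto (fun n => ∫ x, Real.exp (-(s * x)) ∂(μ n : Measure ℝ)) atTop
      (𝓝 (∫ x, Real.exp (-(s * x)) ∂(ν : Measure ℝ)))) :
    Tendsto μ atTop (𝓝 ν) := by
  have hc : IsCompact (closure (Set.range μ)) := by
    refine isCompact_closure_of_isTightMeasureSet ?_
    convert! ht using 1
    ext ρ
    simp
  -- By compactness every ultrafilter finer than `atTop` has a limit law, and its Laplace transform
  -- forces it to be `ν`.
  rw [tendsto_iff_ultrafilter]
  intro g hg
  obtain ⟨ρ, -, hρ⟩ := hc.ultrafilter_le_nhds (Ultrafilter.map μ g) (by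
    rw [le_principal_iff]
    exact Filter.mem_of_superset (Filter.mem_map.2 (Filter.univ_mem' fun n => Set.mem_range_self n))
      subset_closure)
  have hT : Tendsto μ (g : Filter ℕ) (𝓝 ρ) := hρ
  have hρ0 := ae_nonneg_of_tendsto hT hμ
  have : ρ = ν := by
    have := ρ.2
    have := ν.2
    refine Subtype.ext (ext_of_laplace hρ0 hν fun s hs => ?_)
    have hw := (ProbabilityMeasure.tendsto_iff_forall_integral_tendsto.1 hT) (expNegAbsBCF s hs.le)
    simp_rw [integral_expNegAbsBCF (hμ _)] at hw
    rw [integral_expNegAbsBCF hρ0] at hw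
    exact tendsto_nhds_unique hw ((h s hs).mono_left hg)
  rwa [this] at hT

/-! ### The ratio of two independent one-sided stable variables -/

theorem mgf_oneSidedStableLaw {α : ℝ} (h0 : 0 < α) (h1 : α ≤ 1) {t : ℝ} (ht : t < 0) :
    mgf id (oneSidedStableLaw α) t = Real.exp (-(-t) ^ α) := by
  rw [← (oneSidedStableLaw_nonneg_and_laplace h0 h1).2 (-t) (by linarith)]
  simp [mgf]

/-- Differentiate the Laplace transform; `-s` is interior to the domain of the moment generating
function. -/
theorem integral_mul_exp_oneSidedStableLaw {α : ℝ} (h0 : 0 < α) (h1 : α ≤ 1) {s : ℝ} (hs : 0 < s) :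
    ∫ x, x * Real.exp (-(s * x)) ∂(oneSidedStableLaw α) =
      α * s ^ (α - 1) * Real.exp (-s ^ α) := by
  have hd := hasDerivAt_mgf (mem_interior_integrableExpSet_id
    (oneSidedStableLaw_nonneg_and_laplace h0 h1).1 (neg_neg_of_pos hs))
  have hd2 : HasDerivAt (fun t : ℝ => Real.exp (-(-t) ^ α))
      (α * s ^ (α - 1) * Real.exp (-s ^ α)) (-s) := by
    have h := (((hasDerivAt_neg (-s)).rpow_const (p := α) (Or.inl (by simpa using hs.ne'))).neg).exp
    convert! h using 1
    simp only [neg_neg, Pi.neg_apply]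
    ring
  have he : mgf id (oneSidedStableLaw α) =ᶠ[𝓝 (-s)] fun t : ℝ => Real.exp (-(-t) ^ α) := by
    filter_upwards [gt_mem_nhds (neg_neg_of_pos hs)] with t ht using mgf_oneSidedStableLaw h0 h1 ht
  have := hd.unique (hd2.congr_of_eventuallyEq he)
  simpa using this

theorem integral_exp_neg_mul_Ioi_zero {a : ℝ} (ha : 0 < a) :
    ∫ x in Set.Ioi (0 : ℝ), Real.exp (-(a * x)) = 1 / a := by
  have := integral_exp_mul_Ioi (a := -a) (by linarith) 0
  simp only [neg_mul, mul_zero, Real.exp_zero] at this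
  rw [this, neg_div_neg_eq]

theorem integrableOn_exp_neg_mul_Ioi_zero {a : ℝ} (ha : 0 < a) :
    IntegrableOn (fun x : ℝ => Real.exp (-(a * x))) (Set.Ioi 0) := by
  simpa using integrableOn_exp_mul_Ioi (a := -a) (by linarith) 0

/-- The law of `S' / S`, where `S` and `S'` are independent with the one-sided stable law. -/
noncomputable def stableRatioLaw (α : ℝ) : Measure ℝ :=
  ((oneSidedStableLaw α).prod (oneSidedStableLaw α)).map fun p => p.2 / p.1

theorem measurable_snd_div_fst : Measurable fun p : ℝ × ℝ => p.2 / p.1 :=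
  measurable_snd.div measurable_fst

instance isProbabilityMeasure_stableRatioLaw (α : ℝ) : IsProbabilityMeasure (stableRatioLaw α) :=
  Measure.isProbabilityMeasure_map measurable_snd_div_fst.aemeasurable

theorem ae_pos_prod_oneSidedStableLaw {α : ℝ} (h0 : 0 < α) (h1 : α ≤ 1) :
    ∀ᵐ p ∂((oneSidedStableLaw α).prod (oneSidedStableLaw α)), 0 < p.1 ∧ 0 < p.2 := by
  filter_upwards [Measure.quasiMeasurePreserving_fst.ae (ae_pos_oneSidedStableLaw h0 h1),
    Measure.quasiMeasurePreserving_snd.ae (ae_pos_oneSidedStableLaw h0 h1)] with p h h'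
    using ⟨h, h'⟩

theorem ae_pos_stableRatioLaw {α : ℝ} (h0 : 0 < α) (h1 : α ≤ 1) :
    ∀ᵐ t ∂(stableRatioLaw α), 0 < t := by
  rw [stableRatioLaw, ae_map_iff measurable_snd_div_fst.aemeasurable measurableSet_Ioi]
  filter_upwards [ae_pos_prod_oneSidedStableLaw h0 h1] with p hp using div_pos hp.2 hp.1

/-- `1 / (s + S' / S) = S / (s S + S')` is the integral of `S exp (-(s S + S') u)` over `u > 0`.
After Fubini, independence factors the expectation into a derivative of the Laplace transform at `s
u` and its value at `u`; the remaining integral in `u` is elementary. -/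
theorem integral_inv_add_stableRatioLaw {α : ℝ} (h0 : 0 < α) (h1 : α ≤ 1) {s : ℝ} (hs : 0 < s) :
    ∫ t, 1 / (s + t) ∂(stableRatioLaw α) = s ^ (α - 1) / (1 + s ^ α) := by
  set σ := oneSidedStableLaw α with hσ
  rw [stableRatioLaw, integral_map measurable_snd_div_fst.aemeasurable
    (by exact (measurable_const.div (measurable_const.add measurable_id)).aestronglyMeasurable)]
  have hpos := ae_pos_prod_oneSidedStableLaw h0 h1
  let f : ℝ × ℝ → ℝ → ℝ := fun p u => p.1 * Real.exp (-((s * p.1 + p.2) * u))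
  have hfI : ∀ p : ℝ × ℝ, 0 < p.1 ∧ 0 < p.2 →
      ∫ u in Set.Ioi 0, f p u = 1 / (s + p.2 / p.1) := by
    rintro ⟨a, b⟩ ⟨ha, hb⟩
    simp only at ha hb
    simp only [f]
    rw [integral_const_mul, integral_exp_neg_mul_Ioi_zero (by positivity)]
    field_simp
  have hint : Integrable (Function.uncurry f) ((σ.prod σ).prod (volume.restrict (Set.Ioi 0))) := by
    rw [integrable_prod_iff (by simp only [f, Function.uncurry_def]; fun_prop)]
    refine ⟨?_, ?_⟩
    · filter_upwards [hpos] with p hp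
      have : 0 < s * p.1 + p.2 := add_pos (mul_pos hs hp.1) hp.2
      exact (integrableOn_exp_neg_mul_Ioi_zero this).const_mul p.1
    · refine Integrable.of_bound (C := 1 / s) ?_ ?_
      · refine AEStronglyMeasurable.norm (f := Function.uncurry f) ?_ |>.integral_prod_right'
        simp only [f, Function.uncurry_def]
        fun_prop
      · filter_upwards [hpos] with p hp
        have e : ∀ u, ‖Function.uncurry f (p, u)‖ = f p u := fun u =>
          Real.norm_of_nonneg (mul_nonneg hp.1.le (Real.exp_nonneg _))
        simp_rw [e]
        have := div_pos hp.2 hp.1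
        rw [hfI p hp, Real.norm_of_nonneg (by positivity)]
        exact one_div_le_one_div_of_le hs (by linarith)
  calc ∫ p, 1 / (s + p.2 / p.1) ∂(σ.prod σ)
      = ∫ p, (∫ u in Set.Ioi 0, f p u) ∂(σ.prod σ) :=
        integral_congr_ae (hpos.mono fun p hp => (hfI p hp).symm)
    _ = ∫ u in Set.Ioi 0, ∫ p, f p u ∂(σ.prod σ) := integral_integral_swap hint
    _ = ∫ u in Set.Ioi 0, α * s ^ (α - 1) * (u ^ (α - 1) * Real.exp (-(1 + s ^ α) * u ^ α)) := by
        refine setIntegral_congr_fun measurableSet_Ioi fun u hu => ?_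
        have hu : 0 < u := hu
        have e : ∀ p : ℝ × ℝ, f p u = (p.1 * Real.exp (-((s * u) * p.1))) * Real.exp (-(u * p.2)) := by
          intro p
          simp only [f]
          rw [mul_assoc, ← Real.exp_add]
          congr 2
          ring
        simp_rw [e]
        rw [integral_prod_mul (fun a => a * Real.exp (-((s * u) * a))) (fun b => Real.exp (-(u * b))),
          integral_mul_exp_oneSidedStableLaw h0 h1 (mul_pos hs hu),
          (oneSidedStableLaw_nonneg_and_laplace h0 h1).2 u hu, Real.mul_rpow hs.le hu.le,
          Real.mul_rpow hs.le hu.le, mul_assoc, ← Real.exp_add]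
        have : -(s ^ α * u ^ α) + -u ^ α = -(1 + s ^ α) * u ^ α := by ring
        rw [this]
        ring
    _ = s ^ (α - 1) / (1 + s ^ α) := by
        have hb : 0 < 1 + s ^ α := by positivity
        rw [integral_const_mul, integral_rpow_mul_exp_neg_mul_rpow h0 (by linarith) hb]
        rw [sub_add_cancel, div_self h0.ne', neg_div, div_self h0.ne', Real.Gamma_one,
          Real.rpow_neg_one]
        field_simp

/-- The Stieltjes transform is the twice iterated Laplace transform, by Fubini. -/
theorem integral_exp_neg_mul_laplace {τ : Measure ℝ} [IsProbabilityMeasure τ] (hτ : ∀ᵐ t ∂τ, 0 < t)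
    {s : ℝ} (hs : 0 < s) :
    IntegrableOn (fun x => Real.exp (-(s * x)) * ∫ t, Real.exp (-(x * t)) ∂τ) (Set.Ioi 0) ∧
    ∫ x in Set.Ioi 0, Real.exp (-(s * x)) * ∫ t, Real.exp (-(x * t)) ∂τ =
      ∫ t, 1 / (s + t) ∂τ := by
  let f : ℝ → ℝ → ℝ := fun t x => Real.exp (-((s + t) * x))
  have hfI : ∀ t, 0 < t → ∫ x in Set.Ioi 0, f t x = 1 / (s + t) := fun t ht =>
    integral_exp_neg_mul_Ioi_zero (by linarith)
  have hint : Integrable (Function.uncurry f) (τ.prod (volume.restrict (Set.Ioi 0))) := by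
    rw [integrable_prod_iff (by simp only [f, Function.uncurry_def]; fun_prop)]
    refine ⟨?_, ?_⟩
    · filter_upwards [hτ] with t ht
      exact integrableOn_exp_neg_mul_Ioi_zero (a := s + t) (by linarith)
    · refine Integrable.of_bound (C := 1 / s) ?_ ?_
      · refine AEStronglyMeasurable.norm (f := Function.uncurry f) ?_ |>.integral_prod_right'
        simp only [f, Function.uncurry_def]
        fun_prop
      · filter_upwards [hτ] with t ht
        have e : ∀ u, ‖Function.uncurry f (t, u)‖ = f t u := fun u =>
          Real.norm_of_nonneg (Real.exp_nonneg _)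
        simp_rw [e]
        rw [hfI t ht, Real.norm_of_nonneg (by positivity)]
        exact one_div_le_one_div_of_le hs (by linarith)
  have e : ∀ x, ∫ t, f t x ∂τ = Real.exp (-(s * x)) * ∫ t, Real.exp (-(x * t)) ∂τ := by
    intro x
    rw [← integral_const_mul]
    refine integral_congr_ae (ae_of_all _ fun t => ?_)
    simp only [f]
    rw [← Real.exp_add]
    congr 1
    ring
  have e' : (fun x => Real.exp (-(s * x)) * ∫ t, Real.exp (-(x * t)) ∂τ) =
      fun x => ∫ t, f t x ∂τ := funext fun x => (e x).symm
  rw [e']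
  exact ⟨hint.integral_prod_right, (integral_integral_swap hint).symm.trans
    (integral_congr_ae (hτ.mono fun t ht => hfI t ht))⟩

/-! ### The Mittag-Leffler function -/

/-- Keep only the part `x > y` of the Gamma integral and bound `x ^ a` below by `y ^ a` there. With
`y` free, this is enough growth to dominate the Mittag-Leffler series by geometric ones. -/
theorem rpow_mul_exp_neg_le_Gamma {a y : ℝ} (ha : 0 ≤ a) (hy : 0 < y) :
    y ^ a * Real.exp (-y) ≤ Real.Gamma (a + 1) := by
  have hI := Real.GammaIntegral_convergent (s := a + 1) (by linarith)
  rw [Real.Gamma_eq_integral (by linarith), ← integral_exp_neg_Ioi, ← integral_const_mul]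
  refine (setIntegral_mono_on ((integrableOn_exp_neg_Ioi y).const_mul _)
    (hI.mono_set (Set.Ioi_subset_Ioi hy.le)) measurableSet_Ioi fun x hx => ?_).trans
    (setIntegral_mono_set hI ?_ (Set.Ioi_subset_Ioi hy.le).eventuallyLE)
  · rw [mul_comm, add_sub_cancel_right]
    have := Real.rpow_le_rpow hy.le (Set.mem_Ioi.1 hx).le ha
    gcongr
  · filter_upwards [ae_restrict_mem measurableSet_Ioi] with x hx
    have : 0 < x := hx
    positivity

theorem norm_pow_div_Gamma_le {δ : ℝ} (hδ : 0 < δ) {z y : ℝ} (hy : 0 < y) (n : ℕ) :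
    ‖z ^ n / Real.Gamma (δ * n + 1)‖ ≤ Real.exp y * (|z| / y ^ δ) ^ n := by
  have h := rpow_mul_exp_neg_le_Gamma (a := δ * n) (by positivity) hy
  have hp : 0 < y ^ (δ * n) * Real.exp (-y) := by positivity
  rw [norm_div, norm_pow, Real.norm_eq_abs, Real.norm_of_nonneg (hp.le.trans h)]
  refine (div_le_div_of_nonneg_left (by positivity) hp h).trans (le_of_eq ?_)
  rw [Real.rpow_mul hy.le, Real.rpow_natCast, Real.exp_neg, div_pow]
  field_simp

/-- The choice `y = (2 M) ^ (1 / δ)` makes the ratio equal to `1 / 2`. -/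
theorem summable_mittagLeffler_bound {δ : ℝ} (hδ : 0 < δ) {M : ℝ} (hM : 0 < M) :
    Summable fun n : ℕ => Real.exp ((2 * M) ^ δ⁻¹) * (M / ((2 * M) ^ δ⁻¹) ^ δ) ^ n := by
  refine (summable_geometric_of_lt_one (by positivity) ?_).mul_left _
  rw [← Real.rpow_mul (by positivity), inv_mul_cancel₀ hδ.ne', Real.rpow_one,
    div_lt_one (by positivity)]
  linarith

theorem continuous_mittagLefflerE {δ : ℝ} (hδ : 0 < δ) : Continuous (mittagLefflerE δ) := by
  rw [continuous_iff_continuousAt]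
  intro z
  have hM : 0 < |z| + 1 := by positivity
  have hc : ContinuousOn (mittagLefflerE δ) (Metric.ball 0 (|z| + 1)) := by
    refine continuousOn_tsum (fun n => by fun_prop) (summable_mittagLeffler_bound hδ hM)
      fun n w hw => ?_
    have hw : |w| < |z| + 1 := by simpa using hw
    refine (norm_pow_div_Gamma_le hδ (y := (2 * (|z| + 1)) ^ δ⁻¹) (by positivity) n).trans ?_
    gcongr
  exact hc.continuousAt (Metric.isOpen_ball.mem_nhds (by simp))

/-- Termwise, `x ^ (δ n) / Γ(δ n + 1)` has Laplace transform `s ^ (-δ n - 1)`, and a geometric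
series of ratio `-s ^ (-δ)` results. The restriction `s > 1` makes it absolutely convergent, which
justifies the exchange. -/
theorem laplace_mittagLefflerE {δ : ℝ} (hδ : 0 < δ) {s : ℝ} (hs : 1 < s) :
    IntegrableOn (fun x => Real.exp (-(s * x)) * mittagLefflerE δ (-(x ^ δ))) (Set.Ioi 0) ∧
    ∫ x in Set.Ioi 0, Real.exp (-(s * x)) * mittagLefflerE δ (-(x ^ δ)) =
      s ^ (δ - 1) / (1 + s ^ δ) := by
  have hs0 : 0 < s := by linarith
  let g : ℕ → ℝ → ℝ := fun n x =>
    (x ^ (δ * n + 1 - 1) * Real.exp (-(s * x))) / Real.Gamma (δ * n + 1)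
  let F : ℕ → ℝ → ℝ := fun n x => (-1) ^ n * g n x
  have hΓ : ∀ n : ℕ, 0 < Real.Gamma (δ * n + 1) := fun n => Real.Gamma_pos_of_pos (by positivity)
  have hr : (1 / s) ^ δ < 1 := Real.rpow_lt_one (by positivity) (by
    rw [div_lt_one hs0]; exact hs) hδ
  have hgI : ∀ n, ∫ x in Set.Ioi 0, g n x = (1 / s) * ((1 / s) ^ δ) ^ n := by
    intro n
    simp only [g]
    rw [integral_div, Real.integral_rpow_mul_exp_neg_mul_Ioi (by positivity) hs0,
      mul_div_cancel_right₀ _ (hΓ n).ne', Real.rpow_add (by positivity), Real.rpow_mul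
      (by positivity), Real.rpow_natCast, Real.rpow_one, mul_comm]
  have hgi : ∀ n, IntegrableOn (g n) (Set.Ioi 0) := by
    intro n
    -- The Bochner integral of a non-integrable function is `0` by convention, so the positive value
    -- just computed implies integrability.
    refine Integrable.of_integral_ne_zero ?_
    rw [hgI]
    positivity
  have hg0 : ∀ n x, 0 < x → 0 ≤ g n x := fun n x hx => by
    have := hΓ n
    simp only [g]
    positivity
  have hFi : ∀ n, IntegrableOn (F n) (Set.Ioi 0) := fun n => (hgi n).const_mul _
  have hFn : ∀ n, ∫ x in Set.Ioi 0, ‖F n x‖ = (1 / s) * ((1 / s) ^ δ) ^ n := by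
    intro n
    rw [← hgI]
    refine setIntegral_congr_fun measurableSet_Ioi fun x hx => ?_
    simp only [F, norm_mul, norm_pow, norm_neg, norm_one, one_pow, one_mul]
    exact Real.norm_of_nonneg (hg0 n x hx)
  have hsum : Summable fun n => ∫ x in Set.Ioi 0, ‖F n x‖ := by
    simp_rw [hFn]
    exact (summable_geometric_of_lt_one (by positivity) hr).mul_left _
  have hFE : ∀ x, 0 < x → ∑' n, F n x = Real.exp (-(s * x)) * mittagLefflerE δ (-(x ^ δ)) := by
    intro x hx
    rw [mittagLefflerE, ← tsum_mul_left]
    refine tsum_congr fun n => ?_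
    simp only [F, g]
    rw [add_sub_cancel_right, Real.rpow_mul hx.le, Real.rpow_natCast, neg_pow (x ^ δ)]
    ring
  refine ⟨?_, ?_⟩
  · refine ⟨?_, ?_⟩
    · refine (Continuous.aestronglyMeasurable ?_)
      have := continuous_mittagLefflerE hδ
      have : Continuous fun x : ℝ => x ^ δ := Real.continuous_rpow_const hδ.le
      fun_prop
    · have hle : ∫⁻ x in Set.Ioi 0, ∑' n, ‖F n x‖ₑ < ⊤ := by
        rw [lintegral_tsum fun n => (hFi n).1.enorm]
        have : ∀ n, ∫⁻ x in Set.Ioi 0, ‖F n x‖ₑ = ENNReal.ofReal (∫ x in Set.Ioi 0, ‖F n x‖) :=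
          fun n => (ofReal_integral_norm_eq_lintegral_enorm (hFi n)).symm
        simp_rw [this]
        rw [← ENNReal.ofReal_tsum_of_nonneg (fun n => by positivity) hsum]
        exact ENNReal.ofReal_lt_top
      refine lt_of_le_of_lt (lintegral_mono_ae ?_) hle
      filter_upwards [ae_restrict_mem measurableSet_Ioi] with x hx
      rw [← hFE x hx]
      exact enorm_tsum_le_tsum_enorm
  · rw [← setIntegral_congr_fun measurableSet_Ioi (fun x hx => hFE x hx),
      ← integral_tsum_of_summable_integral_norm hFi hsum]
    have e : ∀ n, ∫ x in Set.Ioi 0, F n x = (1 / s) * (-((1 / s) ^ δ)) ^ n := by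
      intro n
      simp only [F]
      rw [integral_const_mul, hgI, neg_pow ((1 / s) ^ δ)]
      ring
    simp_rw [e]
    rw [tsum_mul_left, tsum_geometric_of_norm_lt_one (by
      rw [norm_neg, Real.norm_of_nonneg (by positivity)]; exact hr)]
    rw [Real.div_rpow (by norm_num) hs0.le, Real.one_rpow, Real.rpow_sub_one hs0.ne']
    have h1 : s ^ δ ≠ 0 := by positivity
    have h2 : 1 + s ^ δ ≠ 0 := by positivity
    have h3 : 1 - -(1 / s ^ δ) = (1 + s ^ δ) / s ^ δ := by
      field_simp
      ring
    rw [h3, inv_div]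
    field_simp

/-- Both sides have the same Laplace transform for `s > 1`, hence agree almost everywhere on `(0,
∞)`, and everywhere there by continuity. -/
theorem mittagLefflerE_eq_integral {δ : ℝ} (h0 : 0 < δ) (h1 : δ ≤ 1) {x : ℝ} (hx : 0 < x) :
    mittagLefflerE δ (-(x ^ δ)) = ∫ t, Real.exp (-(x * t)) ∂(stableRatioLaw δ) := by
  set τ := stableRatioLaw δ with hτ
  have hpos := ae_pos_stableRatioLaw h0 h1
  have hL := fun s hs => laplace_mittagLefflerE h0 (s := s) hs
  have hG := fun s hs => integral_exp_neg_mul_laplace hpos (s := s) hs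
  have hcE : Continuous fun x : ℝ => mittagLefflerE δ (-(x ^ δ)) :=
    (continuous_mittagLefflerE h0).comp (Real.continuous_rpow_const h0.le).neg
  -- Replacing `x` by `max x 0` keeps the integrand below `1`, so that dominated convergence applies
  -- on the whole line.
  have hcG : Continuous fun x : ℝ => ∫ t, Real.exp (-(max x 0 * t)) ∂τ := by
    refine continuous_of_dominated (bound := fun _ => 1) (fun x => by fun_prop) (fun x => ?_)
      (integrable_const _) (ae_of_all _ fun t => by fun_prop)
    filter_upwards [hpos] with t ht
    rw [Real.norm_of_nonneg (Real.exp_nonneg _), Real.exp_le_one_iff]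
    have := mul_nonneg (le_max_right x 0) ht.le
    linarith
  have hcG' : ContinuousOn (fun x : ℝ => ∫ t, Real.exp (-(x * t)) ∂τ) (Set.Ioi 0) := by
    refine hcG.continuousOn.congr fun x hx => ?_
    simp only [max_eq_left (Set.mem_Ioi.1 hx).le]
  -- The factor `exp (-2 x)` makes the difference integrable and shifts the transform variable to `s
  -- + 2`, where both transforms are known for every `s > 0`.
  have hz := ae_eq_zero_of_laplace
    (k := fun x => Real.exp (-(2 * x)) * mittagLefflerE δ (-(x ^ δ)) -
      Real.exp (-(2 * x)) * ∫ t, Real.exp (-(x * t)) ∂τ)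
    ((hL 2 (by norm_num)).1.sub (hG 2 (by norm_num)).1) (fun s hs => by
      have e : ∀ x, Real.exp (-(s * x)) * (Real.exp (-(2 * x)) * mittagLefflerE δ (-(x ^ δ)) -
          Real.exp (-(2 * x)) * ∫ t, Real.exp (-(x * t)) ∂τ) =
          Real.exp (-((s + 2) * x)) * mittagLefflerE δ (-(x ^ δ)) -
          Real.exp (-((s + 2) * x)) * ∫ t, Real.exp (-(x * t)) ∂τ := by
        intro x
        rw [add_mul, neg_add, Real.exp_add]
        ring
      simp_rw [e]
      rw [integral_sub (hL (s + 2) (by linarith)).1 (hG (s + 2) (by linarith)).1,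
        (hL (s + 2) (by linarith)).2, (hG (s + 2) (by linarith)).2,
        integral_inv_add_stableRatioLaw h0 h1 (by linarith), sub_self])
  have hae : (fun x : ℝ => mittagLefflerE δ (-(x ^ δ))) =ᵐ[volume.restrict (Set.Ioi 0)]
      fun x : ℝ => ∫ t, Real.exp (-(x * t)) ∂τ := by
    filter_upwards [hz] with x hx
    rw [← mul_sub] at hx
    have := (mul_eq_zero.1 hx).resolve_left (Real.exp_pos _).ne'
    linarith
  exact Measure.eqOn_open_of_ae_eq hae isOpen_Ioi hcE.continuousOn hcG' hx

/-- The Mittag-Leffler law is a mixture of exponential laws. -/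
theorem mittagLefflerDensity_eq {δ : ℝ} (h0 : 0 < δ) (h1 : δ ≤ 1) {x : ℝ} (hx : 0 < x) :
    mittagLefflerDensity δ x = ∫ t, t * Real.exp (-(x * t)) ∂(stableRatioLaw δ) := by
  have hd := hasDerivAt_mgf (mem_interior_integrableExpSet_id
    ((ae_pos_stableRatioLaw h0 h1).mono fun _ h => h.le) (neg_neg_of_pos hx))
  have hd2 := hd.scomp x (hasDerivAt_neg x)
  have he : (fun y : ℝ => mittagLefflerE δ (-(y ^ δ))) =ᶠ[𝓝 x]
      mgf id (stableRatioLaw δ) ∘ Neg.neg := by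
    filter_upwards [lt_mem_nhds hx] with y hy
    rw [mittagLefflerE_eq_integral h0 h1 hy]
    simp [mgf]
  rw [mittagLefflerDensity, (hd2.congr_of_eventuallyEq he).deriv]
  simp

/-! ### The limit laws as mixtures -/

theorem integrable_exp_neg_mul_abs {t : ℝ} (ht : 0 < t) :
    Integrable fun x : ℝ => Real.exp (-(t * |x|)) := by
  rw [← integrableOn_univ, ← Set.Iic_union_Ioi (a := (0 : ℝ)), integrableOn_union]
  constructor
  · refine (integrableOn_exp_mul_Iic ht 0).congr_fun (fun x hx => ?_) measurableSet_Iic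
    simp [abs_of_nonpos (Set.mem_Iic.1 hx)]
  · refine (integrableOn_exp_neg_mul_Ioi_zero ht).congr_fun (fun x hx => ?_) measurableSet_Ioi
    simp [abs_of_pos (Set.mem_Ioi.1 hx)]

/-- The Fourier transform of the symmetric Laplace density. -/
theorem integral_cexp_mul_exp_neg_mul_abs {t : ℝ} (ht : 0 < t) (u : ℝ) :
    ∫ x : ℝ, (Real.exp (-(t * |x|)) : ℂ) * Complex.exp (u * x * Complex.I) =
      ((2 * t / (t ^ 2 + u ^ 2) : ℝ) : ℂ) := by
  have hI : Integrable fun x : ℝ =>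
      (Real.exp (-(t * |x|)) : ℂ) * Complex.exp (u * x * Complex.I) := by
    refine (integrable_exp_neg_mul_abs ht).ofReal.mul_bdd (c := 1) (by fun_prop)
      (ae_of_all _ fun x => ?_)
    rw [← Complex.ofReal_mul, Complex.norm_exp_ofReal_mul_I]
  have e1 : ∫ x in Set.Iic (0 : ℝ), (Real.exp (-(t * |x|)) : ℂ) * Complex.exp (u * x * Complex.I) =
      1 / (t + u * Complex.I) := by
    have := integral_exp_mul_complex_Iic (a := t + u * Complex.I) (by simpa using ht) 0
    rw [Complex.ofReal_zero, mul_zero, Complex.exp_zero] at this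
    rw [← this]
    refine setIntegral_congr_fun measurableSet_Iic fun x hx => ?_
    simp only [abs_of_nonpos (Set.mem_Iic.1 hx), Complex.ofReal_exp, ← Complex.exp_add]
    congr 1
    push_cast
    ring
  have e2 : ∫ x in Set.Ioi (0 : ℝ), (Real.exp (-(t * |x|)) : ℂ) * Complex.exp (u * x * Complex.I) =
      1 / (t - u * Complex.I) := by
    have := integral_exp_mul_complex_Ioi (a := -t + u * Complex.I) (by simpa using ht) 0
    rw [Complex.ofReal_zero, mul_zero, Complex.exp_zero] at this
    have e : (t - u * Complex.I : ℂ) = -(-t + u * Complex.I) := by ring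
    rw [e, one_div, inv_neg, ← one_div, ← neg_div, ← this]
    refine setIntegral_congr_fun measurableSet_Ioi fun x hx => ?_
    simp only [abs_of_pos (Set.mem_Ioi.1 hx), Complex.ofReal_exp, ← Complex.exp_add]
    congr 1
    push_cast
    ring
  rw [← intervalIntegral.integral_Iic_add_Ioi hI.integrableOn hI.integrableOn, e1, e2]
  have h1 : (t + u * Complex.I : ℂ) ≠ 0 := fun h => ht.ne' (by simpa using congrArg Complex.re h)
  have h2 : (t - u * Complex.I : ℂ) ≠ 0 := fun h => ht.ne' (by simpa using congrArg Complex.re h)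
  have h3 : ((t ^ 2 + u ^ 2 : ℝ) : ℂ) = (t + u * Complex.I) * (t - u * Complex.I) := by
    push_cast
    ring_nf
    rw [Complex.I_sq]
    ring
  rw [Complex.ofReal_div, h3, div_add_div _ _ h1 h2]
  congr 1
  push_cast
  ring

/-- The density is the mixture over `t` of the Laplace densities `(t / 2) exp (-t |x|)`, whose
characteristic functions are `t² / (t² + u²)`; Fubini does the rest. -/
theorem charFun_symmMittagLefflerLaw {δ : ℝ} (h0 : 0 < δ) (h1 : δ ≤ 1) (u : ℝ) :
    charFun (symmMittagLefflerLaw δ) u =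
      ((∫ t, t ^ 2 / (t ^ 2 + u ^ 2) ∂(stableRatioLaw δ) : ℝ) : ℂ) := by
  set τ := stableRatioLaw δ with hτ
  have hpos := ae_pos_stableRatioLaw h0 h1
  let q : ℝ → ℝ → ℝ := fun t x => t / 2 * Real.exp (-(t * |x|))
  let ψ : ℝ → ℝ := fun x => ∫ t, q t x ∂τ
  have hq1 : ∀ t, 0 < t → ∫ x, q t x = 1 := by
    intro t ht
    have := integral_cexp_mul_exp_neg_mul_abs ht 0
    simp only [Complex.ofReal_zero, zero_mul, Complex.exp_zero, mul_one] at this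
    rw [integral_complex_ofReal, Complex.ofReal_inj] at this
    simp only [q]
    rw [integral_const_mul, this]
    field_simp
    ring
  have hq : Integrable (Function.uncurry q) (τ.prod volume) := by
    rw [integrable_prod_iff (by simp only [q, Function.uncurry_def]; fun_prop)]
    refine ⟨hpos.mono fun t ht => (integrable_exp_neg_mul_abs ht).const_mul (t / 2), ?_⟩
    refine (integrable_const (1 : ℝ)).congr ?_
    filter_upwards [hpos] with t ht
    rw [← hq1 t ht]
    refine integral_congr_ae (ae_of_all _ fun x => ?_)
    exact (Real.norm_of_nonneg (by simp only [q]; positivity)).symm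
  have hψ : Integrable ψ := hq.integral_prod_right
  have hψ0 : ∀ x, 0 ≤ ψ x := fun x => integral_nonneg_of_ae (hpos.mono fun t ht => by
    simp only [q, Pi.zero_apply]; positivity)
  have hlaw : symmMittagLefflerLaw δ = volume.withDensity fun x => ENNReal.ofReal (ψ x) := by
    refine withDensity_congr_ae ?_
    have : ∀ᵐ x : ℝ, x ≠ 0 := by simp [ae_iff]
    filter_upwards [this] with x hx
    rw [mittagLefflerDensity_eq h0 h1 (abs_pos.2 hx), ← integral_div]
    congr 1
    refine integral_congr_ae (ae_of_all _ fun t => ?_)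
    simp only [q]
    rw [mul_comm |x|]
    ring
  rw [hlaw, charFun_apply_real, integral_withDensity_eq_integral_toReal_smul₀
    hψ.1.aemeasurable.ennreal_ofReal (ae_of_all _ fun _ => ENNReal.ofReal_lt_top)]
  have hc : Integrable (Function.uncurry fun t x : ℝ =>
      (q t x : ℂ) * Complex.exp (u * x * Complex.I)) (τ.prod volume) := by
    refine hq.ofReal.mul_bdd (c := 1) (by fun_prop) (ae_of_all _ fun x => ?_)
    rw [← Complex.ofReal_mul, Complex.norm_exp_ofReal_mul_I]
  calc ∫ x, (ENNReal.ofReal (ψ x)).toReal • Complex.exp (u * x * Complex.I)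
      = ∫ x, ∫ t, (q t x : ℂ) * Complex.exp (u * x * Complex.I) ∂τ := by
        refine integral_congr_ae (ae_of_all _ fun x => ?_)
        simp only [ENNReal.toReal_ofReal (hψ0 x), Complex.real_smul]
        rw [integral_mul_const, integral_complex_ofReal]
    _ = ∫ t, (∫ x : ℝ, (q t x : ℂ) * Complex.exp (u * x * Complex.I)) ∂τ :=
        (integral_integral_swap hc).symm
    _ = ∫ t, ((t ^ 2 / (t ^ 2 + u ^ 2) : ℝ) : ℂ) ∂τ := by
        refine integral_congr_ae (hpos.mono fun t ht => ?_)
        have e : ∀ x : ℝ, (q t x : ℂ) * Complex.exp (u * x * Complex.I) =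
            ((t / 2 : ℝ) : ℂ) * ((Real.exp (-(t * |x|)) : ℂ) * Complex.exp (u * x * Complex.I)) := by
          intro x
          simp only [q]
          push_cast
          ring
        simp only [e]
        rw [integral_const_mul, integral_cexp_mul_exp_neg_mul_abs ht, ← Complex.ofReal_mul]
        congr 1
        ring
    _ = _ := integral_complex_ofReal

/-- The total mass is the value of the characteristic function at `0`. -/
theorem isProbabilityMeasure_symmMittagLefflerLaw {δ : ℝ} (h0 : 0 < δ) (h1 : δ ≤ 1) :
    IsProbabilityMeasure (symmMittagLefflerLaw δ) := by
  have h := charFun_symmMittagLefflerLaw h0 h1 0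
  have e : ∫ t, t ^ 2 / (t ^ 2 + (0 : ℝ) ^ 2) ∂(stableRatioLaw δ) = 1 := by
    rw [integral_congr_ae (g := fun _ => (1 : ℝ))]
    · simp
    · filter_upwards [ae_pos_stableRatioLaw h0 h1] with t ht
      field_simp
      ring
  rw [e, charFun_zero, Complex.ofReal_inj] at h
  exact ⟨(ENNReal.toReal_eq_one_iff _).1 h⟩

theorem ae_nonneg_expMeasure : ∀ᵐ w ∂(expMeasure 1), 0 ≤ w := by
  rw [ae_iff]
  have : {a : ℝ | ¬ 0 ≤ a} = Set.Iio 0 := by ext; simp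
  rw [this, expMeasure, gammaMeasure, withDensity_apply _ measurableSet_Iio]
  exact lintegral_exponentialPDF_of_nonpos le_rfl

instance : IsProbabilityMeasure (expMeasure 1) := isProbabilityMeasure_expMeasure one_pos

theorem integral_exp_neg_mul_expMeasure {c : ℝ} (hc : 0 ≤ c) :
    ∫ w, Real.exp (-(c * w)) ∂(expMeasure 1) = 1 / (1 + c) := by
  have h : expMeasure 1 = volume.withDensity (exponentialPDF 1) := rfl
  rw [h, integral_withDensity_eq_integral_toReal_smul
    (show Measurable (exponentialPDF 1) from (measurable_exponentialPDFReal 1).ennreal_ofReal)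
    (ae_of_all _ fun _ => ENNReal.ofReal_lt_top), ← integral_exp_neg_mul_Ioi_zero (by positivity),
    ← integral_Ici_eq_integral_Ioi, ← integral_indicator measurableSet_Ici]
  refine integral_congr_ae (ae_of_all _ fun w => ?_)
  simp only [exponentialPDF_eq]
  by_cases hw : 0 ≤ w
  · rw [if_pos hw, Set.indicator_of_mem (Set.mem_Ici.2 hw), ENNReal.toReal_ofReal (by positivity),
      one_mul, one_mul, smul_eq_mul, ← Real.exp_add]
    congr 1
    ring
  · rw [if_neg hw, Set.indicator_of_notMem (by simpa using hw)]
    simp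

theorem measurable_mixingLaw_fun :
    Measurable fun p : ℝ × ℝ × ℝ => 2 * p.1 * (p.2.1 / p.2.2) ^ 2 := by
  fun_prop

instance isProbabilityMeasure_mixingLaw (δ : ℝ) : IsProbabilityMeasure (mixingLaw δ) :=
  Measure.isProbabilityMeasure_map measurable_mixingLaw_fun.aemeasurable

theorem ae_nonneg_mixingLaw (δ : ℝ) : ∀ᵐ v ∂(mixingLaw δ), 0 ≤ v := by
  rw [mixingLaw, ae_map_iff measurable_mixingLaw_fun.aemeasurable measurableSet_Ici]
  filter_upwards [Measure.quasiMeasurePreserving_fst.ae ae_nonneg_expMeasure] with p hp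
  positivity

/-- Given `S` and `S'`, the exponential variable integrates to `1 / (1 + (u S / S')²)`, which is `t²
/ (t² + u²)` at `t = S' / S`. Thus the symmetric Mittag-Leffler law is the normal variance mixture
over `H_δ`. -/
theorem laplace_mixingLaw {δ : ℝ} (h0 : 0 < δ) (h1 : δ ≤ 1) (u : ℝ) :
    ∫ v, Real.exp (-(u ^ 2 / 2 * v)) ∂(mixingLaw δ) =
      ∫ t, t ^ 2 / (t ^ 2 + u ^ 2) ∂(stableRatioLaw δ) := by
  rw [mixingLaw, integral_map measurable_mixingLaw_fun.aemeasurable (by fun_prop),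
    integral_prod_symm, stableRatioLaw, integral_map measurable_snd_div_fst.aemeasurable
      (by exact ((measurable_id.pow_const 2).div
        ((measurable_id.pow_const 2).add measurable_const)).aestronglyMeasurable)]
  · refine integral_congr_ae ?_
    filter_upwards [ae_pos_prod_oneSidedStableLaw h0 h1] with p ⟨ha, hb⟩
    have e : ∀ w : ℝ, -(u ^ 2 / 2 * (2 * w * (p.1 / p.2) ^ 2)) =
        -((u * (p.1 / p.2)) ^ 2 * w) := fun w => by ring
    simp only [e]
    rw [integral_exp_neg_mul_expMeasure (by positivity)]
    have : 0 < p.1 ^ 2 := by positivity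
    field_simp
  · refine .of_bound (measurable_mixingLaw_fun.const_mul _ |>.neg.exp.aestronglyMeasurable) 1 ?_
    filter_upwards [Measure.quasiMeasurePreserving_fst.ae ae_nonneg_expMeasure] with p hp
    rw [Real.norm_of_nonneg (Real.exp_nonneg _), Real.exp_le_one_iff, neg_nonpos]
    positivity

/-! ### The Lindeberg central limit theorem, uniformly on compact sets -/

/-- The cubic bound serves below the Lindeberg truncation level and the quadratic one above it. The
constant `4` is crude: for `|x| ≥ 1`, `2 + |x| + x² / 2 ≤ 7 x² / 2`. -/
theorem norm_cexp_taylor_two_le (x : ℝ) :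
    ‖Complex.exp (x * Complex.I) - 1 - x * Complex.I + (x : ℂ) ^ 2 / 2‖ ≤ 4 * |x| ^ 3 ∧
      ‖Complex.exp (x * Complex.I) - 1 - x * Complex.I + (x : ℂ) ^ 2 / 2‖ ≤ 4 * x ^ 2 := by
  have hn : ‖(x : ℂ) * Complex.I‖ = |x| := by simp
  have h0 := abs_nonneg x
  have hsq : x ^ 2 = |x| ^ 2 := (sq_abs x).symm
  rw [hsq]
  rcases le_total |x| 1 with h | h
  · have hb := Complex.exp_bound (x := x * Complex.I) (by rwa [hn]) (n := 3) (by norm_num)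
    have e : Complex.exp (x * Complex.I) - 1 - x * Complex.I + (x : ℂ) ^ 2 / 2 =
        Complex.exp (x * Complex.I) -
          ∑ m ∈ Finset.range 3, (x * Complex.I) ^ m / m.factorial := by
      simp [Finset.sum_range_succ, mul_pow]
      ring
    rw [e]
    rw [hn] at hb
    have h3 : |x| ^ 3 ≤ |x| ^ 2 := pow_le_pow_of_le_one h0 h (by norm_num)
    have hb' := hb.trans (b := |x| ^ 3 * ((Nat.succ 3 : ℝ) * (Nat.factorial 3 * (3 : ℕ) : ℝ)⁻¹))
      (c := |x| ^ 3) (mul_le_of_le_one_right (by positivity) (by norm_num [Nat.factorial]))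
    have : 0 ≤ |x| ^ 3 := by positivity
    constructor <;> linarith
  · have h1 : ‖Complex.exp (x * Complex.I) - 1 - x * Complex.I + (x : ℂ) ^ 2 / 2‖ ≤
        1 + 1 + |x| + |x| ^ 2 / 2 := by
      refine (norm_add_le _ _).trans (add_le_add ((norm_sub_le _ _).trans (add_le_add
        ((norm_sub_le _ _).trans (add_le_add ?_ ?_)) hn.le)) ?_)
      · rw [Complex.norm_exp_ofReal_mul_I]
      · simp
      · simp
    have h2 : |x| ≤ |x| ^ 2 := by nlinarith
    have h3 : |x| ^ 2 ≤ |x| ^ 3 := pow_le_pow_right₀ h (by norm_num)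
    constructor <;> linarith

theorem abs_exp_neg_sub_le {v : ℝ} (hv : 0 ≤ v) : |1 - v - Real.exp (-v)| ≤ v ^ 2 := by
  have h1 := Real.add_one_le_exp (-v)
  rw [abs_sub_comm, abs_of_nonneg (by linarith)]
  rcases le_total v 1 with h | h
  · have := Real.norm_exp_sub_one_sub_id_le (x := -v) (by rwa [norm_neg, Real.norm_of_nonneg hv])
    rw [norm_neg, Real.norm_of_nonneg hv] at this
    have := (le_abs_self _).trans this
    linarith
  · have : Real.exp (-v) ≤ 1 := Real.exp_le_one_iff.2 (by linarith)
    nlinarith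

/-- Exchange the factors one at a time; all the others have modulus at most `1`. -/
theorem norm_prod_sub_prod_le_sum {ι : Type*} (s : Finset ι) {a b : ι → ℂ}
    (ha : ∀ i ∈ s, ‖a i‖ ≤ 1) (hb : ∀ i ∈ s, ‖b i‖ ≤ 1) :
    ‖∏ i ∈ s, a i - ∏ i ∈ s, b i‖ ≤ ∑ i ∈ s, ‖a i - b i‖ := by
  classical
  induction s using Finset.induction_on with
  | empty => simp
  | insert j s hj ih =>
    rw [Finset.prod_insert hj, Finset.prod_insert hj, Finset.sum_insert hj]
    have e : a j * ∏ i ∈ s, a i - b j * ∏ i ∈ s, b i =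
        (a j - b j) * ∏ i ∈ s, a i + b j * (∏ i ∈ s, a i - ∏ i ∈ s, b i) := by ring
    rw [e]
    refine (norm_add_le _ _).trans (add_le_add ?_ ?_)
    · rw [norm_mul]
      refine mul_le_of_le_one_right (norm_nonneg _) ?_
      rw [norm_prod]
      exact Finset.prod_le_one (fun _ _ => norm_nonneg _)
        fun i hi => ha i (Finset.mem_insert_of_mem hi)
    · rw [norm_mul]
      exact (mul_le_of_le_one_left (norm_nonneg _) (hb j (Finset.mem_insert_self _ _))).trans
        (ih (fun i hi => ha i (Finset.mem_insert_of_mem hi))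
          fun i hi => hb i (Finset.mem_insert_of_mem hi))

/-- Both functions are compared with `1 - s² V / 2`, where `V` is the variance. The first two terms
are the Taylor errors on `|Y| ≥ a` and `|Y| < a`; the third bounds the error of `exp (-v) ≈ 1 - v`,
with one factor of `V²` replaced by its bound `a²` plus the truncated moment. -/
theorem norm_charFun_sub_exp_le {Ω : Type*} [MeasurableSpace Ω] {P : Measure Ω}
    [IsProbabilityMeasure P] {Y : Ω → ℝ} (hm : Measurable Y) (hL2 : MemLp Y 2 P)
    (hmean : ∫ ω, Y ω ∂P = 0) (s : ℝ) {a : ℝ} (ha : 0 ≤ a) :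
    ‖charFun (P.map Y) s - (Real.exp (-(s ^ 2 / 2 * variance Y P)) : ℂ)‖ ≤
      4 * s ^ 2 * (∫ ω in {ω | a ≤ |Y ω|}, Y ω ^ 2 ∂P) + 4 * |s| ^ 3 * a * variance Y P +
        s ^ 4 / 4 * (variance Y P * (a ^ 2 + ∫ ω in {ω | a ≤ |Y ω|}, Y ω ^ 2 ∂P)) := by
  have hV : variance Y P = ∫ ω, Y ω ^ 2 ∂P := variance_of_integral_eq_zero hm.aemeasurable hmean
  have hI1 : Integrable Y P := hL2.integrable (by norm_num)
  have hI2 : Integrable (fun ω => Y ω ^ 2) P := hL2.integrable_sq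
  have hA : MeasurableSet {ω | a ≤ |Y ω|} := measurableSet_le measurable_const hm.abs
  set V := variance Y P
  set A := {ω | a ≤ |Y ω|} with hAdef
  set L := ∫ ω in A, Y ω ^ 2 ∂P with hL
  have hLI : ∫ ω, A.indicator (fun ω => Y ω ^ 2) ω ∂P = L := integral_indicator hA
  have hV0 : 0 ≤ V := variance_nonneg _ _
  have hL0 : 0 ≤ L := integral_nonneg fun _ => by positivity
  have hVL : V ≤ a ^ 2 + L := by
    rw [hV, ← hLI]
    have : a ^ 2 = ∫ _ω, a ^ 2 ∂P := by simp
    rw [this, ← integral_add (integrable_const _) (hI2.indicator hA)]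
    refine integral_mono hI2 ((integrable_const _).add (hI2.indicator hA)) fun ω => ?_
    by_cases h : ω ∈ A
    · simp only [Set.indicator_of_mem h]
      nlinarith
    · simp only [Set.indicator_of_notMem h]
      have : |Y ω| < a := not_le.1 h
      have := pow_le_pow_left₀ (abs_nonneg _) this.le 2
      rw [sq_abs] at this
      linarith
  have h1 : ‖charFun (P.map Y) s - (1 - s ^ 2 / 2 * V : ℝ)‖ ≤ 4 * s ^ 2 * L + 4 * |s| ^ 3 * a * V := by
    have hexp : Integrable (fun ω => Complex.exp ((s * Y ω : ℝ) * Complex.I)) P := by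
      refine .of_bound (by fun_prop) 1 (ae_of_all _ fun ω => ?_)
      rw [Complex.norm_exp_ofReal_mul_I]
    have i1 : Integrable (fun ω => ((s * Y ω : ℝ) : ℂ) * Complex.I) P :=
      ((hI1.const_mul s).ofReal).mul_const _
    have i2 : Integrable (fun ω => ((s * Y ω : ℝ) : ℂ) ^ 2 / 2) P := by
      have := ((hI2.const_mul (s ^ 2 / 2)).ofReal (𝕜 := ℂ))
      refine this.congr (ae_of_all _ fun ω => ?_)
      simp
      ring
    have e : charFun (P.map Y) s - (1 - s ^ 2 / 2 * V : ℝ) =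
        ∫ ω, (Complex.exp ((s * Y ω : ℝ) * Complex.I) - 1 - (s * Y ω : ℝ) * Complex.I +
          ((s * Y ω : ℝ) : ℂ) ^ 2 / 2) ∂P := by
      have i3 : Integrable (fun ω => Complex.exp ((s * Y ω : ℝ) * Complex.I) - 1) P :=
        hexp.sub (integrable_const _)
      have i4 : Integrable (fun ω => Complex.exp ((s * Y ω : ℝ) * Complex.I) - 1 -
          (s * Y ω : ℝ) * Complex.I) P := i3.sub i1
      rw [integral_add i4 i2, integral_sub i3 i1, integral_sub hexp (integrable_const _)]
      have j1 : ∫ ω, ((s * Y ω : ℝ) : ℂ) * Complex.I ∂P = 0 := by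
        rw [integral_mul_const, integral_complex_ofReal, integral_const_mul, hmean]
        simp
      have j2 : ∫ ω, ((s * Y ω : ℝ) : ℂ) ^ 2 / 2 ∂P = ((s ^ 2 / 2 * V : ℝ) : ℂ) := by
        rw [hV, ← integral_const_mul, ← integral_complex_ofReal]
        refine integral_congr_ae (ae_of_all _ fun ω => ?_)
        push_cast
        ring
      have j3 : charFun (P.map Y) s = ∫ ω, Complex.exp ((s * Y ω : ℝ) * Complex.I) ∂P := by
        rw [charFun_apply_real, integral_map hm.aemeasurable (by fun_prop)]
        push_cast
        rfl
      rw [j1, j2, j3]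
      simp
      ring
    rw [e]
    have hg : Integrable (fun ω => 4 * s ^ 2 * A.indicator (fun ω => Y ω ^ 2) ω +
        4 * |s| ^ 3 * a * Y ω ^ 2) P :=
      ((hI2.indicator hA).const_mul _).add (hI2.const_mul _)
    refine (norm_integral_le_of_norm_le hg (ae_of_all _ fun ω => ?_)).trans (le_of_eq ?_)
    · obtain ⟨b3, b2⟩ := norm_cexp_taylor_two_le (s * Y ω)
      by_cases h : ω ∈ A
      · simp only [Set.indicator_of_mem h]
        have : 0 ≤ 4 * |s| ^ 3 * a * Y ω ^ 2 := by positivity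
        rw [mul_pow] at b2
        linarith
      · simp only [Set.indicator_of_notMem h]
        have hlt : |Y ω| < a := not_le.1 h
        have hc : |s * Y ω| ^ 3 ≤ |s| ^ 3 * a * Y ω ^ 2 := by
          calc |s * Y ω| ^ 3 = |s| ^ 3 * (Y ω ^ 2 * |Y ω|) := by
                rw [abs_mul, mul_pow, pow_succ |Y ω|, sq_abs]
            _ ≤ |s| ^ 3 * (Y ω ^ 2 * a) := by gcongr
            _ = |s| ^ 3 * a * Y ω ^ 2 := by ring
        linarith
    · rw [integral_add ((hI2.indicator hA).const_mul _) (hI2.const_mul _), integral_const_mul,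
        integral_const_mul, hLI, ← hV]
  have h2 : ‖((1 - s ^ 2 / 2 * V : ℝ) : ℂ) - (Real.exp (-(s ^ 2 / 2 * V)) : ℂ)‖ ≤
      s ^ 4 / 4 * (V * (a ^ 2 + L)) := by
    rw [← Complex.ofReal_sub, Complex.norm_real]
    refine (abs_exp_neg_sub_le (by positivity)).trans ?_
    have : (s ^ 2 / 2 * V) ^ 2 = s ^ 4 / 4 * (V * V) := by ring
    rw [this]
    gcongr
  exact (norm_sub_le_norm_sub_add_norm_sub _ _ _).trans (add_le_add h1 h2)

section Lindeberg

variable {Ω : Type*} [MeasurableSpace Ω] {P : Measure Ω} {X : ℕ → Ω → ℝ}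

theorem varianceSum_nonneg (X : ℕ → Ω → ℝ) (P : Measure Ω) (n : ℕ) : 0 ≤ varianceSum X P n :=
  Finset.sum_nonneg fun _ _ => variance_nonneg _ _

theorem varianceSum_pos (hXvar : ∀ i, 0 < variance (X i) P) {n : ℕ} (hn : 0 < n) :
    0 < varianceSum X P n :=
  Finset.sum_pos (fun i _ => hXvar i) (Finset.nonempty_range_iff.2 hn.ne')

/-- The truncated second moments `B_n⁻² ∑ E[X_i ^ 2; |X_i| ≥ τ B_n]`. -/
noncomputable def lindebergSum (X : ℕ → Ω → ℝ) (P : Measure Ω) (τ : ℝ) (n : ℕ) : ℝ :=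
  1 / varianceSum X P n * ∑ i ∈ Finset.range n,
    ∫ ω in {ω | τ * Real.sqrt (varianceSum X P n) ≤ |X i ω|}, X i ω ^ 2 ∂P

theorem lindebergSum_nonneg (τ : ℝ) (n : ℕ) : 0 ≤ lindebergSum X P τ n :=
  mul_nonneg (one_div_nonneg.2 (varianceSum_nonneg X P n))
    (Finset.sum_nonneg fun _ _ => integral_nonneg fun _ => by positivity)

/-- Sum the one-variable estimate at `s = u / B_n`, with truncation level `a = τ B_n`. The bound
depends on `u` only through powers of `|u|`, whence uniformity on compact sets. -/
theorem norm_charFun_sum_sub_exp_le [IsProbabilityMeasure P]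
    (hXmeas : ∀ i, Measurable (X i)) (hXindep : iIndepFun X P)
    (hXL2 : ∀ i, MemLp (X i) 2 P) (hXmean : ∀ i, ∫ ω, X i ω ∂P = 0)
    (hXvar : ∀ i, 0 < variance (X i) P) {n : ℕ} (hn : 0 < n) {τ : ℝ} (hτ : 0 < τ) (u : ℝ) :
    ‖charFun (P.map fun ω => ∑ i ∈ Finset.range n, X i ω) (u / Real.sqrt (varianceSum X P n)) -
        (Real.exp (-(u ^ 2 / 2)) : ℂ)‖ ≤
      4 * u ^ 2 * lindebergSum X P τ n + 4 * |u| ^ 3 * τ +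
        u ^ 4 / 4 * (τ ^ 2 + lindebergSum X P τ n) := by
  have hB := varianceSum_pos (n := n) hXvar hn
  set B2 := varianceSum X P n with hB2
  set B := Real.sqrt B2 with hBdef
  have hBpos : 0 < B := Real.sqrt_pos.2 hB
  have hBsq : B ^ 2 = B2 := Real.sq_sqrt hB.le
  set s := u / B with hs
  let V : ℕ → ℝ := fun i => variance (X i) P
  let L : ℕ → ℝ := fun i => ∫ ω in {ω | τ * B ≤ |X i ω|}, X i ω ^ 2 ∂P
  have hL0 : ∀ i, 0 ≤ L i := fun i => integral_nonneg fun _ => by positivity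
  have hV0 : ∀ i, 0 ≤ V i := fun i => variance_nonneg _ _
  have hVs : ∑ i ∈ Finset.range n, V i = B2 := rfl
  have hLs : ∑ i ∈ Finset.range n, L i = lindebergSum X P τ n * B2 := by
    simp only [lindebergSum, ← hB2, ← hBdef, L]
    field_simp
  have hcf : charFun (P.map fun ω => ∑ i ∈ Finset.range n, X i ω) s =
      ∏ i ∈ Finset.range n, charFun (P.map (X i)) s := by
    rw [(hXindep.restrict _).charFun_map_fun_finsetSum_eq_prod
      fun i _ => (hXmeas i).aemeasurable, Finset.prod_apply]
  have hexp : (Real.exp (-(u ^ 2 / 2)) : ℂ) =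
      ∏ i ∈ Finset.range n, (Real.exp (-(s ^ 2 / 2 * V i)) : ℂ) := by
    rw [← Complex.ofReal_prod, ← Real.exp_sum, Finset.sum_neg_distrib, ← Finset.mul_sum, hVs, hs,
      div_pow, hBsq]
    congr 3
    field_simp
  rw [hcf, hexp]
  refine (norm_prod_sub_prod_le_sum _ (fun i _ => ?_) (fun i _ => ?_)).trans ?_
  · have := Measure.isProbabilityMeasure_map (μ := P) (hXmeas i).aemeasurable
    exact norm_charFun_le_one (μ := P.map (X i)) s
  · rw [Complex.norm_real, Real.norm_of_nonneg (Real.exp_nonneg _), Real.exp_le_one_iff, neg_nonpos]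
    have := hV0 i
    positivity
  refine (Finset.sum_le_sum fun i _ => norm_charFun_sub_exp_le (hXmeas i) (hXL2 i) (hXmean i) s
    (a := τ * B) (by positivity)).trans ?_
  rw [Finset.sum_add_distrib, Finset.sum_add_distrib, ← Finset.mul_sum, ← Finset.mul_sum,
    ← Finset.mul_sum]
  -- The variances sum to `B_n²`; against the truncated moments, each variance is simply bounded by
  -- `B_n²`.
  have hVL : ∑ i ∈ Finset.range n, V i * ((τ * B) ^ 2 + L i) ≤
      B2 ^ 2 * (τ ^ 2 + lindebergSum X P τ n) := by
    have h1 : ∀ i ∈ Finset.range n, V i * ((τ * B) ^ 2 + L i) ≤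
        (τ * B) ^ 2 * V i + B2 * L i := by
      intro i hi
      have : V i ≤ B2 := Finset.single_le_sum (f := V) (fun j _ => hV0 j) hi
      nlinarith [hL0 i, mul_le_mul_of_nonneg_right this (hL0 i)]
    refine (Finset.sum_le_sum h1).trans (le_of_eq ?_)
    rw [Finset.sum_add_distrib, ← Finset.mul_sum, ← Finset.mul_sum, hVs, hLs, mul_pow, hBsq]
    ring
  change 4 * s ^ 2 * ∑ i ∈ Finset.range n, L i + 4 * |s| ^ 3 * (τ * B) *
    ∑ i ∈ Finset.range n, V i + s ^ 4 / 4 * ∑ i ∈ Finset.range n, V i * ((τ * B) ^ 2 + L i) ≤ _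
  refine add_le_add (add_le_add (le_of_eq ?_) (le_of_eq ?_))
    ((mul_le_mul_of_nonneg_left hVL (by positivity)).trans (le_of_eq ?_))
  · rw [hLs, hs, ← hBsq]
    field_simp
  · rw [hVs, hs, ← hBsq, abs_div, abs_of_pos hBpos]
    field_simp
  · rw [hs, ← hBsq]
    field_simp

/-- **Lindeberg's theorem**, with uniform convergence of the characteristic functions on compact
sets. -/
theorem eventually_norm_charFun_sum_sub_exp_le [IsProbabilityMeasure P]
    (hXmeas : ∀ i, Measurable (X i))
    (hXindep : iIndepFun X P) (hXL2 : ∀ i, MemLp (X i) 2 P) (hXmean : ∀ i, ∫ ω, X i ω ∂P = 0)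
    (hXvar : ∀ i, 0 < variance (X i) P) (hLindeberg : LindebergCondition X P) (T : ℝ) {ε : ℝ}
    (hε : 0 < ε) :
    ∀ᶠ n : ℕ in atTop, ∀ u : ℝ, |u| ≤ T →
      ‖charFun (P.map fun ω => ∑ i ∈ Finset.range n, X i ω) (u / Real.sqrt (varianceSum X P n)) -
        (Real.exp (-(u ^ 2 / 2)) : ℂ)‖ ≤ ε := by
  -- `l` stands for the Lindeberg sum. First `τ` is taken small enough that `F τ 0 < ε`; then `n`
  -- large brings `l` close to `0`.
  let F : ℝ → ℝ → ℝ := fun τ l => 4 * T ^ 2 * l + 4 * T ^ 3 * τ + T ^ 4 / 4 * (τ ^ 2 + l)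
  obtain ⟨τ, hτF, hτ⟩ : ∃ τ, F τ 0 < ε ∧ 0 < τ := by
    have hc : Continuous fun τ => F τ 0 := by simp only [F]; fun_prop
    have := hc.tendsto 0
    have h0 : F 0 0 = 0 := by simp [F]
    rw [h0] at this
    have h1 := (this.eventually (gt_mem_nhds hε)).filter_mono (nhdsWithin_le_nhds (s := Set.Ioi 0))
    exact (h1.and self_mem_nhdsWithin).exists
  have hc : Continuous (F τ) := by simp only [F]; fun_prop
  have hl := ((hc.tendsto 0).comp (hLindeberg τ hτ)).eventually (gt_mem_nhds hτF)
  filter_upwards [hl, eventually_gt_atTop 0] with n hn hn0 u hu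
  refine (norm_charFun_sum_sub_exp_le hXmeas hXindep hXL2 hXmean hXvar hn0 hτ u).trans
    (le_trans ?_ hn.le)
  change _ ≤ F τ (lindebergSum X P τ n)
  simp only [F]
  have hl0 := lindebergSum_nonneg (X := X) (P := P) τ n
  have h2 : u ^ 2 ≤ T ^ 2 := by
    rw [← sq_abs u]
    gcongr
  have h4 : u ^ 4 ≤ T ^ 4 := by
    have : u ^ 4 = |u| ^ 4 := by rw [← abs_pow, abs_of_nonneg (by positivity)]
    rw [this]
    gcongr
  gcongr

end Lindeberg

/-! ### Weak convergence and tightness on the line -/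

theorem convergesInLaw_iff_tendsto {μ : ℕ → ProbabilityMeasure ℝ} {ν : ProbabilityMeasure ℝ} :
    ConvergesInLaw (fun n => (μ n : Measure ℝ)) (ν : Measure ℝ) ↔ Tendsto μ atTop (𝓝 ν) :=
  ProbabilityMeasure.tendsto_iff_forall_integral_tendsto.symm

theorem isTightMeasureSet_range_of_tendsto {μ : ℕ → ProbabilityMeasure ℝ}
    {ν : ProbabilityMeasure ℝ} (h : Tendsto μ atTop (𝓝 ν)) :
    IsTightMeasureSet (Set.range fun n => (μ n : Measure ℝ)) :=
  isTightMeasureSet_of_tendsto_charFun (f := charFun (ν : Measure ℝ))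
    continuous_charFun.continuousAt (ProbabilityMeasure.tendsto_iff_tendsto_charFun.1 h)

theorem exists_measureReal_le_of_isTightMeasureSet {μ : ℕ → Measure ℝ}
    (h : IsTightMeasureSet (Set.range μ)) {η : ℝ} (hη : 0 < η) :
    ∃ M : ℝ, 0 < M ∧ ∀ n, (μ n).real {x | M < |x|} ≤ η := by
  have ht := tendsto_measure_norm_gt_of_isTightMeasureSet h
  have := (ht.eventually (gt_mem_nhds (ENNReal.ofReal_pos.2 hη))).and (eventually_gt_atTop 0)
  obtain ⟨M, hM, hM0⟩ := this.exists
  refine ⟨M, hM0, fun n => ENNReal.toReal_le_of_le_ofReal hη.le (le_trans ?_ hM.le)⟩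
  exact le_iSup₂_of_le (μ n) (Set.mem_range_self n) le_rfl

/-- A bound for large `n` suffices, since the finitely many other measures are finite measures on
the line, each of them tight. -/
theorem isTightMeasureSet_range_of_eventually {μ : ℕ → Measure ℝ} [∀ n, IsFiniteMeasure (μ n)]
    (h : ∀ η : ℝ, 0 < η → ∃ M : ℝ, ∀ᶠ n in atTop, (μ n).real {x | M < |x|} ≤ η) :
    IsTightMeasureSet (Set.range μ) := by
  refine isTightMeasureSet_range_of_tendsto_limsup_measure_norm_gt ?_
  rw [ENNReal.tendsto_atTop_zero]
  intro ε hε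
  -- `ε` may be infinite, hence the truncation at `1` before passing to reals.
  have hm : min ε 1 ≠ ⊤ := (min_le_right _ _).trans_lt ENNReal.one_lt_top |>.ne
  obtain ⟨M, hM⟩ := h (min ε 1).toReal (ENNReal.toReal_pos (lt_min hε one_pos).ne' hm)
  refine ⟨M, fun r hr => limsup_le_of_le (h := ?_)⟩
  filter_upwards [hM] with n hn
  refine (measure_mono fun x hx => ?_).trans
    (((ENNReal.le_ofReal_iff_toReal_le (measure_ne_top _ _) ENNReal.toReal_nonneg).2 hn).trans ?_)
  · exact lt_of_le_of_lt hr hx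
  · rw [ENNReal.ofReal_toReal hm]
    exact min_le_left _ _

/-! ### Sums with an independent random index -/

section RandomIndex

variable {Ω : Type*} [MeasurableSpace Ω] {P : Measure Ω} {X : ℕ → Ω → ℝ}

theorem measurable_partialSum (hX : ∀ i, Measurable (X i)) (k : ℕ) :
    Measurable fun ω => ∑ i ∈ Finset.range k, X i ω :=
  Finset.measurable_fun_sum _ fun i _ => hX i

theorem measurable_randomSum (hX : ∀ i, Measurable (X i)) {N : Ω → ℕ} (hN : Measurable N) :
    Measurable fun ω => ∑ i ∈ Finset.range (N ω), X i ω := by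
  have h : Measurable fun p : ℕ × Ω => ∑ i ∈ Finset.range p.1, X i p.2 :=
    measurable_from_prod_countable_right fun k => measurable_partialSum hX k
  exact h.comp (hN.prodMk measurable_id)

/-- Conditioning on the index: by independence the joint law of `N` and the whole sequence is a
product, and Fubini applies. -/
theorem integral_randomSum [IsProbabilityMeasure P] {E : Type*} [NormedAddCommGroup E]
    [NormedSpace ℝ E] [CompleteSpace E] [MeasurableSpace E] [BorelSpace E]
    [SecondCountableTopology E] (hX : ∀ i, Measurable (X i)) {N : Ω → ℕ} (hN : Measurable N)
    (hNX : IndepFun N (fun ω i => X i ω) P) {F : ℝ → E} (hF : Measurable F) {C : ℝ}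
    (hC : ∀ x, ‖F x‖ ≤ C) :
    ∫ ω, F (∑ i ∈ Finset.range (N ω), X i ω) ∂P =
      ∫ ω, (∫ ω', F (∑ i ∈ Finset.range (N ω), X i ω') ∂P) ∂P := by
  have hY : Measurable fun ω i => X i ω := measurable_pi_lambda _ hX
  let G : ℕ × (ℕ → ℝ) → E := fun p => F (∑ i ∈ Finset.range p.1, p.2 i)
  have hG : Measurable G := measurable_from_prod_countable_right fun k =>
    hF.comp (Finset.measurable_fun_sum (Finset.range k) fun i _ => measurable_pi_apply i)
  have := Measure.isProbabilityMeasure_map (μ := P) hN.aemeasurable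
  have := Measure.isProbabilityMeasure_map (μ := P) hY.aemeasurable
  calc ∫ ω, F (∑ i ∈ Finset.range (N ω), X i ω) ∂P
      = ∫ p, G p ∂(P.map fun ω => (N ω, fun i => X i ω)) :=
        (integral_map (hN.prodMk hY).aemeasurable hG.aestronglyMeasurable).symm
    _ = ∫ k, ∫ y, G (k, y) ∂(P.map fun ω i => X i ω) ∂(P.map N) := by
        rw [(indepFun_iff_map_prod_eq_prod_map_map hN.aemeasurable hY.aemeasurable).1 hNX,
          integral_prod _ (.of_bound hG.aestronglyMeasurable C (ae_of_all _ fun p => hC _))]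
    _ = ∫ ω, (∫ y, G (N ω, y) ∂(P.map fun ω i => X i ω)) ∂P :=
        integral_map hN.aemeasurable (measurable_from_top (f := fun k : ℕ =>
          ∫ y, G (k, y) ∂(P.map fun ω i => X i ω))).stronglyMeasurable.aestronglyMeasurable
    _ = _ := by
        refine integral_congr_ae (ae_of_all _ fun ω => ?_)
        exact integral_map hY.aemeasurable
          (hG.comp (measurable_const.prodMk measurable_id)).aestronglyMeasurable

theorem charFun_randomSum [IsProbabilityMeasure P] (hX : ∀ i, Measurable (X i)) {N : Ω → ℕ}
    (hN : Measurable N) (hNX : IndepFun N (fun ω i => X i ω) P) (d t : ℝ) :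
    charFun (P.map fun ω => (∑ i ∈ Finset.range (N ω), X i ω) / d) t =
      ∫ ω, charFun (P.map fun ω' => ∑ i ∈ Finset.range (N ω), X i ω') (t / d) ∂P := by
  rw [charFun_apply_real, integral_map ((measurable_randomSum hX hN).div_const d).aemeasurable
    (by fun_prop), integral_randomSum hX hN hNX
    (F := fun x : ℝ => Complex.exp (t * (x / d : ℝ) * Complex.I)) (by fun_prop) (C := 1)
    (fun x => by rw [← Complex.ofReal_mul, Complex.norm_exp_ofReal_mul_I])]
  refine integral_congr_ae (ae_of_all _ fun ω => ?_)
  simp only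
  rw [charFun_apply_real, integral_map (measurable_partialSum hX _).aemeasurable (by fun_prop)]
  refine integral_congr_ae (ae_of_all _ fun ω' => ?_)
  simp only
  congr 2
  push_cast
  ring

theorem measureReal_randomSum [IsProbabilityMeasure P] (hX : ∀ i, Measurable (X i)) {N : Ω → ℕ}
    (hN : Measurable N) (hNX : IndepFun N (fun ω i => X i ω) P) {A : Set ℝ}
    (hA : MeasurableSet A) :
    P.real {ω | ∑ i ∈ Finset.range (N ω), X i ω ∈ A} =
      ∫ ω, P.real {ω' | ∑ i ∈ Finset.range (N ω), X i ω' ∈ A} ∂P := by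
  have h := integral_randomSum hX hN hNX (F := A.indicator (1 : ℝ → ℝ))
    (measurable_one.indicator hA) (C := 1) (fun x => by
      by_cases hx : x ∈ A <;> simp [hx])
  have e : ∀ {Z : Ω → ℝ}, Measurable Z → ∫ ω, A.indicator (1 : ℝ → ℝ) (Z ω) ∂P =
      P.real {ω | Z ω ∈ A} := by
    intro Z hZ
    exact (integral_indicator_one (μ := P) (hZ hA) :)
  rw [e (measurable_randomSum hX hN)] at h
  rw [h]
  exact integral_congr_ae (ae_of_all _ fun ω => e (measurable_partialSum hX _))

/-- A variable whose characteristic function is bounded away from `1` is not concentrated near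
zero. -/
theorem one_sub_re_charFun_le [IsProbabilityMeasure P] {Z : Ω → ℝ} (hZ : Measurable Z) (s c : ℝ) :
    1 - (charFun (P.map Z) s).re ≤ (s * c) ^ 2 / 2 + 2 * P.real {ω | c < |Z ω|} := by
  have hI : Integrable (fun ω => Complex.exp (s * Z ω * Complex.I)) P := by
    refine .of_bound (by fun_prop) 1 (ae_of_all _ fun ω => ?_)
    rw [← Complex.ofReal_mul, Complex.norm_exp_ofReal_mul_I]
  have hre : (charFun (P.map Z) s).re = ∫ ω, Real.cos (s * Z ω) ∂P := by
    rw [charFun_apply_real, integral_map hZ.aemeasurable (by fun_prop)]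
    rw [← RCLike.re_to_complex, ← integral_re hI]
    refine integral_congr_ae (ae_of_all _ fun ω => ?_)
    simp only [RCLike.re_to_complex]
    rw [← Complex.ofReal_mul, Complex.exp_ofReal_mul_I_re]
  have hcos : Integrable (fun ω => Real.cos (s * Z ω)) P :=
    .of_bound (by fun_prop) 1 (ae_of_all _ fun ω => Real.abs_cos_le_one _)
  have hA : MeasurableSet {ω | c < |Z ω|} := measurableSet_lt measurable_const hZ.abs
  have hind : Integrable ({ω | c < |Z ω|}.indicator (1 : Ω → ℝ)) P :=
    (integrable_const 1).indicator hA
  have e1 : 1 - ∫ ω, Real.cos (s * Z ω) ∂P = ∫ ω, (1 - Real.cos (s * Z ω)) ∂P := by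
    rw [integral_sub (integrable_const _) hcos]
    simp
  have e2 : (s * c) ^ 2 / 2 + 2 * P.real {ω | c < |Z ω|} =
      ∫ ω, ((s * c) ^ 2 / 2 + 2 * {ω | c < |Z ω|}.indicator (1 : Ω → ℝ) ω) ∂P := by
    rw [integral_add (integrable_const _) (hind.const_mul 2), integral_const_mul,
      integral_indicator_one hA]
    simp
  rw [hre, e1, e2]
  refine integral_mono ((integrable_const _).sub hcos)
    ((integrable_const _).add (hind.const_mul 2)) fun ω => ?_
  by_cases h : c < |Z ω|
  · have h1 : ({ω | c < |Z ω|}.indicator (1 : Ω → ℝ) ω) = 1 := Set.indicator_of_mem (s := {ω | c < |Z ω|}) h 1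
    simp only [h1]
    have := Real.neg_one_le_cos (s * Z ω)
    have : 0 ≤ (s * c) ^ 2 / 2 := by positivity
    linarith
  · have h1 : ({ω | c < |Z ω|}.indicator (1 : Ω → ℝ) ω) = 0 := Set.indicator_of_notMem (s := {ω | c < |Z ω|}) h 1
    simp only [h1]
    have h2 := Real.one_sub_sq_div_two_le_cos (x := s * Z ω)
    have h3 : (s * Z ω) ^ 2 ≤ (s * c) ^ 2 := by
      rw [mul_pow, mul_pow, ← sq_abs (Z ω)]
      have := not_lt.1 h
      gcongr
    linarith

end RandomIndex

/-! ### The transfer theorem -/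

section Transfer

variable {Ω : Type*} [MeasurableSpace Ω] {P : Measure Ω} {X : ℕ → Ω → ℝ}

theorem TendsToInftyInProbability.tendsto_measureReal_lt [IsProbabilityMeasure P]
    {N : ℕ → Ω → ℕ} (hN : TendsToInftyInProbability N P) (K : ℕ) :
    Tendsto (fun n => P.real {ω | N n ω < K}) atTop (𝓝 0) := by
  have h := hN (K + 1) (by positivity)
  have h' := (ENNReal.tendsto_toReal ENNReal.zero_ne_top).comp h
  refine squeeze_zero (fun _ => measureReal_nonneg) (fun n => ?_) h'
  refine measureReal_mono (fun ω hω => ?_)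
  have : N n ω < K := hω
  have : (N n ω : ℝ) < K := by exact_mod_cast this
  simp only [Set.mem_ofPred_eq]
  linarith

/-- If the squared norming constants `B_N ^ 2 / d ^ 2` are tight, the random sum is asymptotically a
scale mixture of normal laws. -/
theorem tendsto_charFun_randomSum_sub [IsProbabilityMeasure P] (hXmeas : ∀ i, Measurable (X i))
    (hXindep : iIndepFun X P) (hXL2 : ∀ i, MemLp (X i) 2 P) (hXmean : ∀ i, ∫ ω, X i ω ∂P = 0)
    (hXvar : ∀ i, 0 < variance (X i) P) (hLindeberg : LindebergCondition X P)
    {N : ℕ → Ω → ℕ} (hNmeas : ∀ n, Measurable (N n))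
    (hNindep : ∀ n, IndepFun (N n) (fun ω i => X i ω) P) (hN : TendsToInftyInProbability N P)
    {d : ℕ → ℝ} (hd : ∀ n, 0 < d n)
    (ht : ∀ η : ℝ, 0 < η → ∃ M : ℝ, ∀ᶠ n in atTop,
      P.real {ω | M < varianceSum X P (N n ω) / d n ^ 2} ≤ η) (t : ℝ) :
    Tendsto (fun n =>
      charFun (P.map fun ω => (∑ i ∈ Finset.range (N n ω), X i ω) / d n) t -
        ((∫ ω, Real.exp (-(t ^ 2 / 2 * (varianceSum X P (N n ω) / d n ^ 2))) ∂P : ℝ) : ℂ))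
      atTop (𝓝 0) := by
  rw [Metric.tendsto_nhds]
  intro ε hε
  -- Error budget: `ε / 8` from Lindeberg's theorem, and twice `ε / 8` from each of the events `V_n
  -- > M` and `N_n < K`, on which the difference is bounded by `2`. The total is `5 ε / 8`.
  obtain ⟨M, hM⟩ := ht (ε / 8) (by positivity)
  have hLin := eventually_norm_charFun_sum_sub_exp_le hXmeas hXindep hXL2 hXmean hXvar hLindeberg
    (|t| * Real.sqrt M) (ε := ε / 8) (by positivity)
  -- Adding one to `K₀` ensures `N_n ≥ 1` off the exceptional event, so that `B_{N_n} > 0`.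
  obtain ⟨K₀, hK₀⟩ := eventually_atTop.1 hLin
  set K := K₀ + 1
  have hNK := (hN.tendsto_measureReal_lt K).eventually
    (gt_mem_nhds (show (0 : ℝ) < ε / 8 by positivity))
  filter_upwards [hM, hNK] with n hn hnK
  rw [dist_zero_right, charFun_randomSum hXmeas (hNmeas n) (hNindep n), ← integral_complex_ofReal]
  have hmeas : ∀ {β : Type} [MeasurableSpace β] (g : ℕ → β), Measurable fun ω => g (N n ω) :=
    fun g => measurable_from_top.comp (hNmeas n)
  have hφ : ∀ k s, ‖charFun (P.map fun ω => ∑ i ∈ Finset.range k, X i ω) s‖ ≤ 1 := fun k s => by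
    have := Measure.isProbabilityMeasure_map (μ := P) (measurable_partialSum hXmeas k).aemeasurable
    exact norm_charFun_le_one s
  have hexp : ∀ k, ‖(Real.exp (-(t ^ 2 / 2 * (varianceSum X P k / d n ^ 2))) : ℂ)‖ ≤ 1 := fun k => by
    rw [Complex.norm_real, Real.norm_of_nonneg (Real.exp_nonneg _), Real.exp_le_one_iff, neg_nonpos]
    have := varianceSum_nonneg X P k
    positivity
  have i1 : Integrable (fun ω =>
      charFun (P.map fun ω' => ∑ i ∈ Finset.range (N n ω), X i ω') (t / d n)) P :=
    .of_bound (hmeas fun k => charFun (P.map fun ω' => ∑ i ∈ Finset.range k, X i ω')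
      (t / d n)).aestronglyMeasurable 1 (ae_of_all _ fun ω => hφ _ _)
  have i2 : Integrable (fun ω =>
      (Real.exp (-(t ^ 2 / 2 * (varianceSum X P (N n ω) / d n ^ 2))) : ℂ)) P :=
    .of_bound (hmeas fun k => (Real.exp (-(t ^ 2 / 2 * (varianceSum X P k / d n ^ 2))) : ℂ)
      ).aestronglyMeasurable 1 (ae_of_all _ fun ω => hexp _)
  rw [← integral_sub i1 i2]
  set A := {ω | M < varianceSum X P (N n ω) / d n ^ 2} with hA
  set A' := {ω | N n ω < K} with hA'
  have mA : MeasurableSet A :=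
    measurableSet_lt measurable_const (hmeas fun k => varianceSum X P k / d n ^ 2)
  have mA' : MeasurableSet A' := measurableSet_lt (hNmeas n) measurable_const
  have j1 : Integrable (A.indicator (1 : Ω → ℝ)) P := (integrable_const 1).indicator mA
  have j2 : Integrable (A'.indicator (1 : Ω → ℝ)) P := (integrable_const 1).indicator mA'
  have j3 : Integrable (fun ω => 2 * A.indicator (1 : Ω → ℝ) ω + 2 * A'.indicator (1 : Ω → ℝ) ω) P :=
    (j1.const_mul 2).add (j2.const_mul 2)
  have hbound : ∀ ω, ‖charFun (P.map fun ω' => ∑ i ∈ Finset.range (N n ω), X i ω') (t / d n) -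
      (Real.exp (-(t ^ 2 / 2 * (varianceSum X P (N n ω) / d n ^ 2))) : ℂ)‖ ≤
      ε / 8 + (2 * A.indicator (1 : Ω → ℝ) ω + 2 * A'.indicator (1 : Ω → ℝ) ω) := by
    intro ω
    have p1 : 0 ≤ A.indicator (1 : Ω → ℝ) ω := Set.indicator_nonneg (by simp) _
    have p2 : 0 ≤ A'.indicator (1 : Ω → ℝ) ω := Set.indicator_nonneg (by simp) _
    have htriv : ‖charFun (P.map fun ω' => ∑ i ∈ Finset.range (N n ω), X i ω') (t / d n) -
        (Real.exp (-(t ^ 2 / 2 * (varianceSum X P (N n ω) / d n ^ 2))) : ℂ)‖ ≤ 2 :=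
      (norm_sub_le _ _).trans (by linarith [hφ (N n ω) (t / d n), hexp (N n ω)])
    by_cases hω : ω ∈ A
    · rw [Set.indicator_of_mem hω, Pi.one_apply]
      linarith
    by_cases hω' : ω ∈ A'
    · rw [Set.indicator_of_mem hω', Pi.one_apply]
      linarith
    have hk : K ≤ N n ω := not_lt.1 hω'
    have hv : varianceSum X P (N n ω) / d n ^ 2 ≤ M := not_lt.1 hω
    have hB := varianceSum_pos hXvar (n := N n ω) (by omega)
    have hBs := Real.sqrt_pos.2 hB
    have hdn := hd n
    -- With `u = t B_k / d_n` the argument `u / B_k` is `t / d_n`, and `V_n ≤ M` means `|u| ≤ |t|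
    -- √M`.
    have hu := hK₀ (N n ω) (by omega) (t * (Real.sqrt (varianceSum X P (N n ω)) / d n)) (by
      rw [abs_mul]
      refine mul_le_mul_of_nonneg_left ?_ (abs_nonneg t)
      rw [abs_of_nonneg (by positivity)]
      refine Real.le_sqrt_of_sq_le ?_
      rwa [div_pow, Real.sq_sqrt hB.le])
    have e1 : t * (Real.sqrt (varianceSum X P (N n ω)) / d n) /
        Real.sqrt (varianceSum X P (N n ω)) = t / d n := by field_simp
    have e2 : (t * (Real.sqrt (varianceSum X P (N n ω)) / d n)) ^ 2 / 2 =
        t ^ 2 / 2 * (varianceSum X P (N n ω) / d n ^ 2) := by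
      rw [mul_pow, div_pow, Real.sq_sqrt hB.le]
      ring
    rw [e1, e2] at hu
    linarith
  calc _ ≤ ∫ ω, (ε / 8 + (2 * A.indicator (1 : Ω → ℝ) ω + 2 * A'.indicator (1 : Ω → ℝ) ω)) ∂P :=
        norm_integral_le_of_norm_le ((integrable_const _).add j3) (ae_of_all _ hbound)
    _ = ε / 8 + (2 * P.real A + 2 * P.real A') := by
        rw [integral_add (integrable_const _) j3, integral_add (j1.const_mul 2) (j2.const_mul 2),
          integral_const_mul, integral_const_mul, integral_indicator_one mA,
          integral_indicator_one mA']
        simp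
    _ < ε := by linarith

/-- Partial sums under the Lindeberg condition are not small compared with `B_n`. -/
theorem eventually_le_measureReal_partialSum [IsProbabilityMeasure P]
    (hXmeas : ∀ i, Measurable (X i))
    (hXindep : iIndepFun X P) (hXL2 : ∀ i, MemLp (X i) 2 P) (hXmean : ∀ i, ∫ ω, X i ω ∂P = 0)
    (hXvar : ∀ i, 0 < variance (X i) P) (hLindeberg : LindebergCondition X P) :
    ∀ᶠ k : ℕ in atTop, 1 / 16 ≤ P.real {ω | Real.sqrt (varianceSum X P k) / 2 <
      |∑ i ∈ Finset.range k, X i ω|} := by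
  filter_upwards [eventually_norm_charFun_sum_sub_exp_le hXmeas hXindep hXL2 hXmean hXvar hLindeberg
    1 (ε := 1 / 20) (by norm_num), eventually_gt_atTop 0] with k hk hk0
  have hB := Real.sqrt_pos.2 (varianceSum_pos hXvar hk0)
  have h1 := hk 1 (by simp)
  have h2 := one_sub_re_charFun_le (P := P) (measurable_partialSum hXmeas k)
    (1 / Real.sqrt (varianceSum X P k)) (Real.sqrt (varianceSum X P k) / 2)
  have e1 : 1 / Real.sqrt (varianceSum X P k) * (Real.sqrt (varianceSum X P k) / 2) = 1 / 2 := by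
    field_simp
  rw [e1] at h2
  have h3 := (Complex.re_le_norm _).trans h1
  rw [Complex.sub_re, Complex.ofReal_re] at h3
  -- The real part of the characteristic function at `1 / B_k` is at most `13 / 20 + 1 / 20 = 7 /
  -- 10`. Hence `3 / 10 ≤ 1 / 8 + 2 p`, and the probability `p` is at least `7 / 80 > 1 / 16`.
  have h4 : Real.exp (-(1 ^ 2 / 2)) ≤ 13 / 20 := by
    rw [Real.exp_neg, inv_le_comm₀ (Real.exp_pos _) (by norm_num)]
    have hq := Real.quadratic_le_exp_of_nonneg (x := 1 / 2) (by norm_num)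
    norm_num at hq ⊢
    linarith
  linarith

/-- Tightness of the normalized random sums implies tightness of the norming constants. -/
theorem exists_measureReal_varianceSum_le [IsProbabilityMeasure P] (hXmeas : ∀ i, Measurable (X i))
    (hXindep : iIndepFun X P) (hXL2 : ∀ i, MemLp (X i) 2 P) (hXmean : ∀ i, ∫ ω, X i ω ∂P = 0)
    (hXvar : ∀ i, 0 < variance (X i) P) (hLindeberg : LindebergCondition X P)
    {N : ℕ → Ω → ℕ} (hNmeas : ∀ n, Measurable (N n))
    (hNindep : ∀ n, IndepFun (N n) (fun ω i => X i ω) P) (hN : TendsToInftyInProbability N P)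
    {d : ℕ → ℝ} (hd : ∀ n, 0 < d n)
    (ht : ∀ η : ℝ, 0 < η → ∃ M : ℝ, 0 < M ∧ ∀ n,
      P.real {ω | M < |(∑ i ∈ Finset.range (N n ω), X i ω) / d n|} ≤ η) {η : ℝ} (hη : 0 < η) :
    ∃ M : ℝ, ∀ᶠ n in atTop, P.real {ω | M < varianceSum X P (N n ω) / d n ^ 2} ≤ η := by
  -- The lower bound `1 / 16` turns `η / 32` into `η / 2`; the other half of `η` is spent on `N_n <
  -- K`.
  obtain ⟨M, hM0, hM⟩ := ht (η / 32) (by positivity)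
  obtain ⟨K, hK⟩ := eventually_atTop.1 (eventually_le_measureReal_partialSum hXmeas hXindep hXL2
    hXmean hXvar hLindeberg)
  -- If `B_k / d_n > 2 M`, then `|S*_k| > B_k / 2` implies `|S*_k / d_n| > M`.
  refine ⟨(2 * M) ^ 2, ?_⟩
  filter_upwards [(hN.tendsto_measureReal_lt K).eventually
    (gt_mem_nhds (show (0 : ℝ) < η / 2 by positivity))] with n hn
  have hdn := hd n
  set A := {ω | (2 * M) ^ 2 < varianceSum X P (N n ω) / d n ^ 2 ∧ K ≤ N n ω} with hA
  have hmeas : ∀ (g : ℕ → ℝ), Measurable fun ω => g (N n ω) :=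
    fun g => measurable_from_top.comp (hNmeas n)
  have mA : MeasurableSet A :=
    (measurableSet_lt measurable_const (hmeas fun k => varianceSum X P k / d n ^ 2)).inter
      (measurableSet_le measurable_const (hNmeas n))
  have hS : MeasurableSet {x : ℝ | M < |x / d n|} :=
    measurableSet_lt measurable_const (measurable_id.div_const _).abs
  have hcond := measureReal_randomSum hXmeas (hNmeas n) (hNindep n) hS
  have hle : 1 / 16 * P.real A ≤
      P.real {ω | M < |(∑ i ∈ Finset.range (N n ω), X i ω) / d n|} := by
    rw [← integral_indicator_one mA, ← integral_const_mul]
    refine le_trans ?_ hcond.symm.le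
    refine integral_mono (((integrable_const (1 : ℝ)).indicator mA).const_mul _)
      (.of_bound (hmeas fun k => P.real {ω' | ∑ i ∈ Finset.range k, X i ω' ∈
        {x : ℝ | M < |x / d n|}}).aestronglyMeasurable 1 (ae_of_all _ fun ω => ?_)) fun ω => ?_
    · rw [Real.norm_of_nonneg measureReal_nonneg]
      exact measureReal_le_one
    by_cases hω : ω ∈ A
    · simp only [Set.indicator_of_mem hω, Pi.one_apply, mul_one]
      refine (hK _ hω.2).trans (measureReal_mono fun ω' hω' => ?_)
      have h1 : 2 * M < Real.sqrt (varianceSum X P (N n ω)) / d n := by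
        have := hω.1
        rw [← Real.sq_sqrt (varianceSum_nonneg X P (N n ω)), ← div_pow] at this
        exact lt_of_pow_lt_pow_left₀ 2 (by positivity) this
      have h2 : Real.sqrt (varianceSum X P (N n ω)) / 2 <
        |∑ i ∈ Finset.range (N n ω), X i ω'| := hω'
      simp only [Set.mem_ofPred_eq]
      rw [abs_div, abs_of_pos hdn, lt_div_iff₀ hdn]
      rw [lt_div_iff₀ hdn] at h1
      linarith
    · simp only [Set.indicator_of_notMem hω, mul_zero]
      exact measureReal_nonneg
  have hsub : {ω | (2 * M) ^ 2 < varianceSum X P (N n ω) / d n ^ 2} ⊆ A ∪ {ω | N n ω < K} := by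
    intro ω hω
    by_cases h : N n ω < K
    · exact Or.inr h
    · exact Or.inl ⟨hω, not_lt.1 h⟩
  have h1 := (measureReal_mono (μ := P) hsub).trans (measureReal_union_le _ _)
  have h2 := hM n
  linarith

end Transfer

/-! ### The equivalence of the two convergences -/

theorem theorem10 {Ω : Type*} [MeasurableSpace Ω] (P : Measure Ω) [IsProbabilityMeasure P]
    (δ : ℝ) (hδ0 : 0 < δ) (hδ1 : δ ≤ 1)
    (X : ℕ → Ω → ℝ) (hXmeas : ∀ i, Measurable (X i)) (hXindep : iIndepFun X P)
    (hXL2 : ∀ i, MemLp (X i) 2 P) (hXmean : ∀ i, ∫ ω, X i ω ∂P = 0)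
    (hXvar : ∀ i, 0 < variance (X i) P)
    (hLindeberg : LindebergCondition X P)
    (N : ℕ → Ω → ℕ) (hNmeas : ∀ n, Measurable (N n))
    (hNindep : ∀ n, IndepFun (N n) (fun ω i => X i ω) P)
    (hN : TendsToInftyInProbability N P)
    (d : ℕ → ℝ) (hdpos : ∀ n, 0 < d n) (hd : Tendsto d atTop atTop) :
    ConvergesInLaw
        (fun n => P.map fun ω => (∑ i ∈ Finset.range (N n ω), X i ω) / d n)
        (symmMittagLefflerLaw δ) ↔
      ConvergesInLaw
        (fun n => P.map fun ω => varianceSum X P (N n ω) / d n ^ 2)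
        (mixingLaw δ) := by
  have hSm : ∀ n, Measurable fun ω => (∑ i ∈ Finset.range (N n ω), X i ω) / d n :=
    fun n => (measurable_randomSum hXmeas (hNmeas n)).div_const _
  have hVm : ∀ n, Measurable fun ω => varianceSum X P (N n ω) / d n ^ 2 := fun n =>
    (measurable_from_top (f := fun k : ℕ => varianceSum X P k / d n ^ 2)).comp (hNmeas n)
  let μ : ℕ → ProbabilityMeasure ℝ := fun n =>
    ⟨P.map fun ω => (∑ i ∈ Finset.range (N n ω), X i ω) / d n,
      Measure.isProbabilityMeasure_map (hSm n).aemeasurable⟩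
  let ν : ℕ → ProbabilityMeasure ℝ := fun n =>
    ⟨P.map fun ω => varianceSum X P (N n ω) / d n ^ 2,
      Measure.isProbabilityMeasure_map (hVm n).aemeasurable⟩
  let μ₀ : ProbabilityMeasure ℝ :=
    ⟨symmMittagLefflerLaw δ, isProbabilityMeasure_symmMittagLefflerLaw hδ0 hδ1⟩
  let ν₀ : ProbabilityMeasure ℝ := ⟨mixingLaw δ, inferInstance⟩
  have hVnn : ∀ n ω, 0 ≤ varianceSum X P (N n ω) / d n ^ 2 := fun n ω =>
    div_nonneg (varianceSum_nonneg X P _) (by positivity)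
  have hν_nonneg : ∀ n, ∀ᵐ x ∂(ν n : Measure ℝ), 0 ≤ x := fun n =>
    (ae_map_iff (hVm n).aemeasurable measurableSet_Ici).2 (ae_of_all _ (hVnn n))
  have hν₀_nonneg : ∀ᵐ x ∂(ν₀ : Measure ℝ), 0 ≤ x := ae_nonneg_mixingLaw δ
  have hμ_real : ∀ n M, (μ n : Measure ℝ).real {x | M < |x|} =
      P.real {ω | M < |(∑ i ∈ Finset.range (N n ω), X i ω) / d n|} := fun n M =>
    map_measureReal_apply (hSm n) (measurableSet_lt measurable_const measurable_id.abs)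
  have hν_real : ∀ n M, (ν n : Measure ℝ).real {x | M < |x|} =
      P.real {ω | M < varianceSum X P (N n ω) / d n ^ 2} := fun n M => by
    refine (map_measureReal_apply (hVm n)
      (measurableSet_lt measurable_const measurable_id.abs)).trans ?_
    simp only [Set.preimage, Set.mem_ofPred_eq, id, abs_of_nonneg (hVnn n _)]
  have hν_laplace : ∀ n s, ∫ x, Real.exp (-(s * x)) ∂(ν n : Measure ℝ) =
      ∫ ω, Real.exp (-(s * (varianceSum X P (N n ω) / d n ^ 2))) ∂P := fun n s =>
    integral_map (hVm n).aemeasurable (by fun_prop)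
  have hlim : ∀ t, charFun (μ₀ : Measure ℝ) t =
      ((∫ x, Real.exp (-(t ^ 2 / 2 * x)) ∂(ν₀ : Measure ℝ) : ℝ) : ℂ) := fun t =>
    (charFun_symmMittagLefflerLaw hδ0 hδ1 t).trans
      (congrArg _ (laplace_mixingLaw hδ0 hδ1 t).symm)
  -- The bridge between the two sides, conditional on tightness of `V_n`, which each direction
  -- obtains differently.
  have hdiff : (∀ η : ℝ, 0 < η → ∃ M : ℝ, ∀ᶠ n in atTop,
      P.real {ω | M < varianceSum X P (N n ω) / d n ^ 2} ≤ η) → ∀ t, Tendsto (fun n =>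
        charFun (μ n : Measure ℝ) t -
          ((∫ x, Real.exp (-(t ^ 2 / 2 * x)) ∂(ν n : Measure ℝ) : ℝ) : ℂ)) atTop (𝓝 0) := by
    intro ht t
    simp_rw [hν_laplace]
    exact tendsto_charFun_randomSum_sub hXmeas hXindep hXL2 hXmean hXvar hLindeberg hNmeas hNindep
      hN hdpos ht t
  change ConvergesInLaw (fun n => (μ n : Measure ℝ)) (μ₀ : Measure ℝ) ↔
    ConvergesInLaw (fun n => (ν n : Measure ℝ)) (ν₀ : Measure ℝ)
  rw [convergesInLaw_iff_tendsto, convergesInLaw_iff_tendsto]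
  constructor
  · intro h
    have hV := fun η hη => exists_measureReal_varianceSum_le hXmeas hXindep hXL2 hXmean hXvar
      hLindeberg hNmeas hNindep hN hdpos (fun η hη => by
        obtain ⟨M, hM0, hM⟩ := exists_measureReal_le_of_isTightMeasureSet
          (isTightMeasureSet_range_of_tendsto h) hη
        exact ⟨M, hM0, fun n => (hμ_real n M).symm.trans_le (hM n)⟩) (η := η) hη
    refine tendsto_of_tendsto_laplace hν_nonneg hν₀_nonneg
      (isTightMeasureSet_range_of_eventually fun η hη => ?_) fun s hs => ?_
    · obtain ⟨M, hM⟩ := hV η hη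
      exact ⟨M, hM.mono fun n hn => (hν_real n M).trans_le hn⟩
    -- At `t = √(2 s)` one has `t² / 2 = s`, so convergence of characteristic functions becomes
    -- convergence of Laplace transforms at `s`.
    · have hcf := (ProbabilityMeasure.tendsto_iff_tendsto_charFun.1 h (Real.sqrt (2 * s))).sub
        (hdiff hV (Real.sqrt (2 * s)))
      have e : Real.sqrt (2 * s) ^ 2 / 2 = s := by
        rw [Real.sq_sqrt (by positivity)]
        ring
      simp only [sub_sub_cancel, sub_zero, hlim, e] at hcf
      simpa only [Function.comp_def, Complex.ofReal_re] using
        (Complex.continuous_re.tendsto _).comp hcf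
  · intro h
    have hV : ∀ η : ℝ, 0 < η → ∃ M : ℝ, ∀ᶠ n in atTop,
        P.real {ω | M < varianceSum X P (N n ω) / d n ^ 2} ≤ η := fun η hη => by
      obtain ⟨M, -, hM⟩ := exists_measureReal_le_of_isTightMeasureSet
        (isTightMeasureSet_range_of_tendsto h) hη
      exact ⟨M, .of_forall fun n => (hν_real n M).symm.trans_le (hM n)⟩
    refine ProbabilityMeasure.tendsto_iff_tendsto_charFun.2 fun t => ?_
    have hw := (ProbabilityMeasure.tendsto_iff_forall_integral_tendsto.1 h)
      (expNegAbsBCF (t ^ 2 / 2) (by positivity))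
    simp_rw [integral_expNegAbsBCF (hν_nonneg _)] at hw
    rw [integral_expNegAbsBCF hν₀_nonneg] at hw
    have := (hdiff hV t).add ((Complex.continuous_ofReal.tendsto _).comp hw)
    simpa only [Function.comp_def, sub_add_cancel, zero_add, ← hlim] using this
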